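/- Logarithms are to base $2$ and all Hilbert spaces are finite dimensional. For a state $\rho$ let $S(\rho)=-\mathrm{Tr}\,\rho\log\rho$ and, for $0\le\alpha<1$, $S_\alpha(\rho)=\frac1{1-\alpha}\log\mathrm{Tr}\,\rho^\alpha$, where $\rho^\alpha$ is taken on the support of $\rho$ (so $S_0(\rho)=\log\mathrm{rank}\,\rho$). The convex-roof measure $E_\alpha$ of a bipartite state $\rho$ on $\mathcal H_A\otimes\mathcal H_B$ is $$E_\alpha(\rho)=\inf\Big\{\sum_i p_i\,S_\alpha(\mathrm{Tr}_B|\psi_i\rangle\langle\psi_i|)\Big\},$$ the infimum over all finite ensembles of unit vectors $\psi_i$ with probabilities $p_i$ such that $\rho=\sum_i p_i|\psi_i\rangle\langle\psi_i|$. For $n\ge0$ and real $\delta$ let $\Pi_{n,\delta}$ be the spectral projection of $\rho^{\otimes n}$ onto the eigenvalues in $[2^{-n(S(\rho)+\delta)},2^{-n(S(\rho)-\delta)}]$, and let $\rho_{typ}^{(n,\delta)}=\Pi_{n,\delta}\rho^{\otimes n}\Pi_{n,\delta}/\mathrm{Tr}(\Pi_{n,\delta}\rho^{\otimes n})$ be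 the typical-subspace compression. A real function $f$ of states (on spaces of all finite dimensions) is asymptotically continuous if for every $\varepsilon>0$ there are $\eta>0$ and $D$ such that $|f(\rho)-f(\sigma)|\le\varepsilon\log d$ for all states $\rho,\sigma$ on a common space of dimension $d\ge D$ with $\|\rho-\sigma\|_1<\eta$. For a function of bipartite states, $d$ is the dimension of $\mathcal H_A\otimes\mathcal H_B$. Such a function $E$ admits locking if for every $K$ there is a state $\rho_{AA':B}$, with $A'$ a single qubit, such that $E(\rho_{AA':B})-E(\mathrm{Tr}_{A'}\rho_{AA':B})\ge K$. Let $0\le\alpha<1$. Then: 1. For every state $\rho$, $S(\rho)\le S_\alpha(\rho)$, with equality if and only if all nonzero eigenvalues of $\rho$ coincide. 2. For every state $\rho$ and every $n$, $S_\alpha(\rho^{\otimes n})=nS_\alpha(\rho)$. If $\sqrt n\,\delta_n\to\infty$, then $\rho_{typ}^{(n,\delta_n)}$ is a state for all large $n$ and $\|\rho^{\otimes n}-\rho_{typ}^{(n,\delta_n)}\|_1\to0$. If moreover $\delta_n\to0$, then $\frac1nS_\alpha(\rho_{typ}^{(n,\delta_n)})\to S(\rho)$, and hence $$\tfrac1n\big(S_\alpha(\rho^{\otimes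 n})-S_\alpha(\rho_{typ}^{(n,\delta_n)})\big)\to S_\alpha(\rho)-S(\rho).$$ 3. $S_\alpha$ is not asymptotically continuous. 4. $E_\alpha$ is convex on the states of each bipartite system, and $E_\alpha(|\psi\rangle\langle\psi|)=S_\alpha(\mathrm{Tr}_B|\psi\rangle\langle\psi|)$ for every unit vector $\psi$. 5. Let $\psi\in\mathcal H_A\otimes\mathcal H_B$ be a unit vector with reduced state $\rho=\mathrm{Tr}_B|\psi\rangle\langle\psi|$. Regard $\Psi_n=|\psi\rangle\langle\psi|^{\otimes n}$ as a bipartite state on $\mathcal H_A^{\otimes n}\otimes\mathcal H_B^{\otimes n}$, and let $\Psi_{n,\delta}$ be the normalized compression of $\Psi_n$ by $\Pi_{n,\delta}\otimes I$, whose reduction to $\mathcal H_A^{\otimes n}$ is $\rho_{typ}^{(n,\delta)}$. Then $E_\alpha(\Psi_n)=nS_\alpha(\rho)$. If $\sqrt n\,\delta_n\to\infty$, then $\Psi_{n,\delta_n}$ is a state for all large $n$ and $\|\Psi_n-\Psi_{n,\delta_n}\|_1\to0$. If moreover $\delta_n\to0$, then $\frac1n\big(E_\alpha(\Psi_n)-E_\alpha(\Psi_{n,\delta_n})\big)\to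 S_\alpha(\rho)-S(\rho)$. 6. $E_\alpha$ is not asymptotically continuous, and $E_\alpha$ admits locking. -/

import Mathlib

open Filter Topology
open scoped ComplexOrder Matrix Kronecker

/-- Density matrices (states) of a system with orthonormal basis indexed by `ι`. -/
def IsState {ι : Type} [Fintype ι] [DecidableEq ι] (ρ : Matrix ι ι ℂ) : Prop :=
  ρ.PosSemidef ∧ ρ.trace = 1

/-- The trace norm `Tr √(M† M)`. -/
noncomputable def traceNorm {ι : Type} [Fintype ι] [DecidableEq ι] (M : Matrix ι ι ℂ) : ℝ :=
  (cfc Real.sqrt (Mᴴ * M)).trace.re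

/-- The von Neumann entropy `- Tr ρ log₂ ρ` (functional calculus; `0 log 0 = 0`). -/
noncomputable def vonNeumannEntropy {ι : Type} [Fintype ι] [DecidableEq ι]
    (ρ : Matrix ι ι ℂ) : ℝ :=
  (cfc (fun x : ℝ => -(x * Real.logb 2 x)) ρ).trace.re

/-- The Rényi entropy `(1 - α)⁻¹ log₂ Tr ρ^α`. The power `ρ^α` is taken on the support of `ρ`,
so that for `α = 0` it is the support projection and the entropy is `log₂ (rank ρ)`. -/
noncomputable def renyiEntropy (α : ℝ) {ι : Type} [Fintype ι] [DecidableEq ι]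
    (ρ : Matrix ι ι ℂ) : ℝ :=
  (1 / (1 - α)) *
    Real.logb 2 (cfc (fun x : ℝ => if x = 0 then 0 else x ^ α) ρ).trace.re

/-- The `n`-fold tensor power `ρ^{⊗n}`. -/
def tensorPower {ι : Type} (ρ : Matrix ι ι ℂ) (n : ℕ) :
    Matrix (Fin n → ι) (Fin n → ι) ℂ :=
  Matrix.of fun x y => ∏ i, ρ (x i) (y i)

/-- The projection onto the span of those eigenvectors of `ρ^{⊗n}` whose eigenvalue is
`δ`-typical, that is, lies between `2^{-n(S(ρ)+δ)}` and `2^{-n(S(ρ)-δ)}`. -/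
noncomputable def typicalProjection {ι : Type} [Fintype ι] [DecidableEq ι]
    (ρ : Matrix ι ι ℂ) (n : ℕ) (δ : ℝ) : Matrix (Fin n → ι) (Fin n → ι) ℂ :=
  cfc ((Set.Icc ((2 : ℝ) ^ (-((n : ℝ) * (vonNeumannEntropy ρ + δ))))
      ((2 : ℝ) ^ (-((n : ℝ) * (vonNeumannEntropy ρ - δ))))).indicator (fun _ : ℝ => (1 : ℝ)))
    (tensorPower ρ n)

/-- The normalized compression `P σ P / Tr (P σ)` of a state `σ` by a projection `P`. -/
noncomputable def compress {ι : Type} [Fintype ι] (P σ : Matrix ι ι ℂ) : Matrix ι ι ℂ :=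
  ((P * σ).trace)⁻¹ • (P * σ * P)

/-- The compression `ρ_typ` of `ρ^{⊗n}` to its `δ`-typical subspace. -/
noncomputable def typicalState {ι : Type} [Fintype ι] [DecidableEq ι]
    (ρ : Matrix ι ι ℂ) (n : ℕ) (δ : ℝ) : Matrix (Fin n → ι) (Fin n → ι) ℂ :=
  compress (typicalProjection ρ n δ) (tensorPower ρ n)

/-- Unit vectors. -/
def IsUnitVector {ι : Type} [Fintype ι] (ψ : ι → ℂ) : Prop := ∑ i, ‖ψ i‖ ^ 2 = 1

/-- The rank-one matrix `|ψ⟩⟨ψ|`. -/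
def pureState {ι : Type} (ψ : ι → ℂ) : Matrix ι ι ℂ := Matrix.vecMulVec ψ (star ψ)

/-- The reduction to Alice's system: the partial trace over Bob's system. -/
def reduceA {A B : Type} [Fintype B] (ρ : Matrix (A × B) (A × B) ℂ) : Matrix A A ℂ :=
  Matrix.of fun a a' => ∑ b, ρ (a, b) (a', b)

/-- The vector `ψ^{⊗n}`, as a bipartite vector: all of Alice's copies against all of Bob's. -/
def bipartitePower {A B : Type} (ψ : A × B → ℂ) (n : ℕ) :
    (Fin n → A) × (Fin n → B) → ℂ :=
  fun x => ∏ i, ψ (x.1 i, x.2 i)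

/-- The pure state `ψ^{⊗n}` compressed on Alice's side to the `δ`-typical subspace of her
reduced state. -/
noncomputable def bipartiteTypicalState {A B : Type} [Fintype A] [DecidableEq A]
    [Fintype B] [DecidableEq B] (ψ : A × B → ℂ) (n : ℕ) (δ : ℝ) :
    Matrix ((Fin n → A) × (Fin n → B)) ((Fin n → A) × (Fin n → B)) ℂ :=
  compress
    (typicalProjection (reduceA (pureState ψ)) n δ ⊗ₖ
      (1 : Matrix (Fin n → B) (Fin n → B) ℂ))
    (pureState (bipartitePower ψ n))

/-- The convex-roof measure built from the Rényi entropy: the infimum of the average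
`∑ i, p i * S_α(Tr_B |ψ i⟩⟨ψ i|)` over all finite pure-state ensembles `{p i, ψ i}` of `ρ`. -/
noncomputable def renyiRoof (α : ℝ) (A B : Type) [Fintype A] [DecidableEq A]
    [Fintype B] [DecidableEq B] (ρ : Matrix (A × B) (A × B) ℂ) : ℝ :=
  sInf {e : ℝ | ∃ (k : ℕ) (p : Fin k → ℝ) (ψ : Fin k → A × B → ℂ),
    (∀ i, 0 ≤ p i) ∧ ∑ i, p i = 1 ∧ (∀ i, IsUnitVector (ψ i)) ∧
    ρ = ∑ i, p i • pureState (ψ i) ∧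
    e = ∑ i, p i * renyiEntropy α (reduceA (pureState (ψ i)))}

/-- Asymptotic continuity of a function of states: its density `f / log d` is continuous,
uniformly in the dimension `d`, for large `d`. It fails exactly if there are `Δ > 0` and states
`ρₙ`, `σₙ` on spaces of increasing dimensions `dₙ`, approaching each other in trace norm, with
`|f ρₙ - f σₙ| / log dₙ ≥ Δ`. -/
def AsymptoticallyContinuous
    (f : ∀ (ι : Type) [Fintype ι] [DecidableEq ι], Matrix ι ι ℂ → ℝ) : Prop :=
  ∀ ε : ℝ, 0 < ε → ∃ η : ℝ, 0 < η ∧ ∃ D : ℕ,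
    ∀ (ι : Type) [Fintype ι] [DecidableEq ι], D ≤ Fintype.card ι →
      ∀ ρ σ : Matrix ι ι ℂ, IsState ρ → IsState σ → traceNorm (ρ - σ) < η →
        |f ι ρ - f ι σ| ≤ ε * Real.logb 2 (Fintype.card ι)

/-- The same for a function of bipartite states; `d` is the dimension of the joint system. -/
def BipartiteAsymptoticallyContinuous
    (E : ∀ (A B : Type) [Fintype A] [DecidableEq A] [Fintype B] [DecidableEq B],
      Matrix (A × B) (A × B) ℂ → ℝ) : Prop :=
  ∀ ε : ℝ, 0 < ε → ∃ η : ℝ, 0 < η ∧ ∃ D : ℕ,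
    ∀ (A B : Type) [Fintype A] [DecidableEq A] [Fintype B] [DecidableEq B],
      D ≤ Fintype.card (A × B) →
      ∀ ρ σ : Matrix (A × B) (A × B) ℂ, IsState ρ → IsState σ → traceNorm (ρ - σ) < η →
        |E A B ρ - E A B σ| ≤ ε * Real.logb 2 (Fintype.card (A × B))

/-- Discarding (tracing out) a qubit held by Alice. -/
def discardQubit {A B : Type} (ρ : Matrix ((A × Fin 2) × B) ((A × Fin 2) × B) ℂ) :
    Matrix (A × B) (A × B) ℂ :=
  Matrix.of fun x y => ∑ q : Fin 2, ρ ((x.1, q), x.2) ((y.1, q), y.2)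

/-- Locking: discarding a single qubit can decrease `E` by an arbitrarily large amount. -/
def AdmitsLocking
    (E : ∀ (A B : Type) [Fintype A] [DecidableEq A] [Fintype B] [DecidableEq B],
      Matrix (A × B) (A × B) ℂ → ℝ) : Prop :=
  ∀ K : ℝ, ∃ (m n : ℕ)
    (ρ : Matrix ((Fin m × Fin 2) × Fin n) ((Fin m × Fin 2) × Fin n) ℂ),
    IsState ρ ∧ K ≤ E (Fin m × Fin 2) (Fin n) ρ - E (Fin m) (Fin n) (discardQubit ρ)

/-! Everything about a single state reduces to its eigenvalue list `p`: functional calculus, trace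
norm and tensor power all act on eigenvalues in a fixed unitary frame (`cfc_spectralMatrix`,
`tensorPower_spectralMatrix`). Moreover Tr ρ^α is the expectation of p^(α-1) under p itself.
Jensen's inequality for the logarithm then gives S ≤ S_α, and strict concavity gives the equality
case (`jensen_powerSum`). The same formula pins S_α between -log of the largest and -log of the
smallest nonzero eigenvalue (`logb_powerSum_mem_Icc`), so α hardly matters on a nearly flat
spectrum. By Chebyshev's inequality (`one_sub_typicalMass_le`) the typical compression keeps mass
tending to 1, so it is close to ρ^{⊗n} in trace norm. Its spectrum is flat up to factors 2^{±nδ}, so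
its S_α is nS + o(n), against nS_α(ρ) for ρ^{⊗n}. A pure state has only the trivial ensemble, so the
convex roof of a pure state is the entropy of its reduction. A compression of a pure state is again
pure, and trace distances of pure states come from overlaps; this carries the witness over to E_α.
Both discontinuity claims use the spectrum with weight 1-ε on one point and ε spread over d others:
its S_α is at least log d plus a constant depending on α and ε, whereas at ε = 0 it vanishes. For
locking, take ε = 1/2 and let a flag qubit record which level occurs. Discarding the flag turns the
superposition of the two levels into an equal mixture, whose roof is at most (log d)/2 by convexity.
-/

/-- The matrix with eigenvectors the columns of `U` and eigenvalues `d`. -/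
noncomputable def spectralMatrix {ι : Type} [Fintype ι] [DecidableEq ι] (U : Matrix ι ι ℂ)
    (d : ι → ℝ) : Matrix ι ι ℂ :=
  U * Matrix.diagonal (fun i => (d i : ℂ)) * Uᴴ

/-! ### Functional calculus in a fixed unitary frame. -/

section spectral

variable {ι : Type} [Fintype ι] [DecidableEq ι] {U : Matrix ι ι ℂ}

theorem conjTranspose_mul_of_unitary (hU : U ∈ Matrix.unitaryGroup ι ℂ) : Uᴴ * U = 1 :=
  Matrix.mem_unitaryGroup_iff'.1 hU

theorem mul_conjTranspose_of_unitary (hU : U ∈ Matrix.unitaryGroup ι ℂ) : U * Uᴴ = 1 :=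
  Matrix.mem_unitaryGroup_iff.1 hU

theorem spectralMatrix_mul (hU : U ∈ Matrix.unitaryGroup ι ℂ) (d e : ι → ℝ) :
    spectralMatrix U d * spectralMatrix U e = spectralMatrix U (d * e) := by
  have h : Matrix.diagonal (fun i => ((d * e) i : ℂ)) =
      Matrix.diagonal (fun i => (d i : ℂ)) * Matrix.diagonal (fun i => (e i : ℂ)) := by
    simp [Matrix.diagonal_mul_diagonal]
  rw [spectralMatrix, spectralMatrix, spectralMatrix, h]
  simp only [Matrix.mul_assoc]
  rw [← Matrix.mul_assoc Uᴴ U, conjTranspose_mul_of_unitary hU, Matrix.one_mul]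

theorem spectralMatrix_const (hU : U ∈ Matrix.unitaryGroup ι ℂ) (r : ℝ) :
    spectralMatrix U (fun _ => r) = algebraMap ℝ _ r := by
  have h : Matrix.diagonal (fun _ : ι => (r : ℂ)) = (r : ℂ) • 1 := by
    rw [Matrix.smul_one_eq_diagonal]
  rw [spectralMatrix, h, Matrix.mul_smul, Matrix.mul_one, Matrix.smul_mul,
    mul_conjTranspose_of_unitary hU, Algebra.algebraMap_eq_smul_one]
  ext i j
  simp

theorem spectralMatrix_add (d e : ι → ℝ) :
    spectralMatrix U (d + e) = spectralMatrix U d + spectralMatrix U e := by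
  have h : Matrix.diagonal (fun i => ((d + e) i : ℂ)) =
      Matrix.diagonal (fun i => (d i : ℂ)) + Matrix.diagonal (fun i => (e i : ℂ)) := by
    simp [Matrix.diagonal_add]
  rw [spectralMatrix, spectralMatrix, spectralMatrix, h, Matrix.mul_add, Matrix.add_mul]

theorem spectralMatrix_smul (c : ℝ) (d : ι → ℝ) :
    spectralMatrix U (c • d) = (c : ℂ) • spectralMatrix U d := by
  have h : Matrix.diagonal (fun i => ((c • d) i : ℂ)) =
      (c : ℂ) • Matrix.diagonal (fun i => (d i : ℂ)) := by
    ext i j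
    by_cases hij : i = j <;> simp [hij]
  rw [spectralMatrix, spectralMatrix, h, Matrix.mul_smul, Matrix.smul_mul]

theorem spectralMatrix_sub (d e : ι → ℝ) :
    spectralMatrix U (d - e) = spectralMatrix U d - spectralMatrix U e := by
  rw [eq_sub_iff_add_eq, ← spectralMatrix_add, sub_add_cancel]

theorem spectralMatrix_one (d : ι → ℝ) :
    spectralMatrix 1 d = Matrix.diagonal (fun i => (d i : ℂ)) := by
  simp [spectralMatrix]

/-- Matrices diagonal in the frame `U`, as an image of the algebra of their eigenvalues. -/
noncomputable def spectralAlgHom (hU : U ∈ Matrix.unitaryGroup ι ℂ) :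
    (ι → ℝ) →ₐ[ℝ] Matrix ι ι ℂ where
  toFun := spectralMatrix U
  map_one' := (spectralMatrix_const hU 1).trans (map_one _)
  map_mul' d e := (spectralMatrix_mul hU d e).symm
  map_zero' := (spectralMatrix_const hU 0).trans (map_zero _)
  map_add' := spectralMatrix_add
  commutes' r := spectralMatrix_const hU r

theorem spectralMatrix_conjTranspose (d : ι → ℝ) :
    (spectralMatrix U d)ᴴ = spectralMatrix U d := by
  have h : (Matrix.diagonal fun i => (d i : ℂ))ᴴ = Matrix.diagonal fun i => (d i : ℂ) := by
    rw [Matrix.diagonal_conjTranspose]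
    congr 1
    ext i
    simp
  simp only [spectralMatrix, Matrix.conjTranspose_mul, Matrix.conjTranspose_conjTranspose, h,
    Matrix.mul_assoc]

/-- The spectrum is contained in the finite set of values of `d`, so `f` may be replaced by its
Lagrange interpolant there, and polynomials commute with algebra homomorphisms. No continuity of `f`
is needed, which admits indicators and powers cut off at 0. -/
theorem cfc_spectralMatrix (hU : U ∈ Matrix.unitaryGroup ι ℂ) (f : ℝ → ℝ) (d : ι → ℝ) :
    cfc f (spectralMatrix U d) = spectralMatrix U (f ∘ d) := by
  set q := Lagrange.interpolate (Finset.univ.image d) id f with hq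
  have hqd (i : ι) : q.eval (d i) = f (d i) :=
    Lagrange.eval_interpolate_at_node (v := id) f (Function.injective_id.injOn)
      (Finset.mem_image_of_mem d (Finset.mem_univ i))
  have hsub : spectrum ℝ (spectralMatrix U d) ⊆ Set.range d := by
    refine (AlgHom.spectrum_apply_subset (spectralAlgHom hU) d).trans ?_
    rw [Pi.spectrum_eq]
    intro x hx
    obtain ⟨i, hi⟩ := Set.mem_iUnion.1 hx
    rw [spectrum.mem_iff, isUnit_iff_ne_zero, not_not, sub_eq_zero] at hi
    exact ⟨i, hi.symm⟩
  have hsa : IsSelfAdjoint (spectralMatrix U d) := spectralMatrix_conjTranspose d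
  have hcongr : cfc f (spectralMatrix U d) = cfc q.eval (spectralMatrix U d) := by
    refine cfc_congr fun x hx => ?_
    obtain ⟨i, rfl⟩ := hsub hx
    exact (hqd i).symm
  rw [hcongr, cfc_polynomial q _ hsa]
  change Polynomial.aeval (spectralAlgHom hU d) q = spectralAlgHom hU (f ∘ d)
  rw [Polynomial.aeval_algHom_apply]
  congr 1
  ext i
  rw [Polynomial.aeval_fn_apply, Polynomial.coe_aeval_eq_eval, hqd, Function.comp_apply]

theorem trace_spectralMatrix (hU : U ∈ Matrix.unitaryGroup ι ℂ) (d : ι → ℝ) :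
    (spectralMatrix U d).trace = ((∑ i, d i : ℝ) : ℂ) := by
  rw [spectralMatrix, Matrix.trace_mul_comm, ← Matrix.mul_assoc, conjTranspose_mul_of_unitary hU,
    Matrix.one_mul, Matrix.trace_diagonal, Complex.ofReal_sum]

/-- Conjugating back by `U` recovers the diagonal. This turns quadratic matrix identities into
identities between eigenvalues. -/
theorem spectralMatrix_injective (hU : U ∈ Matrix.unitaryGroup ι ℂ) :
    Function.Injective (spectralMatrix U) := by
  intro d e h
  have key (d : ι → ℝ) : Uᴴ * spectralMatrix U d * U = Matrix.diagonal (fun i => (d i : ℂ)) := by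
    simp only [spectralMatrix, Matrix.mul_assoc, conjTranspose_mul_of_unitary hU, Matrix.mul_one]
    rw [← Matrix.mul_assoc, conjTranspose_mul_of_unitary hU, Matrix.one_mul]
  have h2 : Matrix.diagonal (fun i => (d i : ℂ)) = Matrix.diagonal (fun i => (e i : ℂ)) := by
    rw [← key, ← key, h]
  ext i
  exact_mod_cast Matrix.diagonal_eq_diagonal_iff.1 h2 i

theorem spectralMatrix_posSemidef {d : ι → ℝ} (hd : ∀ i, 0 ≤ d i) :
    (spectralMatrix U d).PosSemidef := by
  apply Matrix.PosSemidef.mul_mul_conjTranspose_same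
  exact Matrix.PosSemidef.diagonal fun i => by simpa using hd i

theorem Matrix.PosSemidef.exists_spectralMatrix {ρ : Matrix ι ι ℂ} (hρ : ρ.PosSemidef) :
    ∃ U ∈ Matrix.unitaryGroup ι ℂ, ∃ p : ι → ℝ, (∀ i, 0 ≤ p i) ∧ ρ = spectralMatrix U p := by
  have hH := hρ.isHermitian
  refine ⟨_, hH.eigenvectorUnitary.2, hH.eigenvalues, hρ.eigenvalues_nonneg, ?_⟩
  conv_lhs => rw [hH.spectral_theorem, Unitary.conjStarAlgAut_apply]
  rfl

theorem IsState.exists_spectralMatrix {ρ : Matrix ι ι ℂ} (hρ : IsState ρ) :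
    ∃ U ∈ Matrix.unitaryGroup ι ℂ, ∃ p : ι → ℝ, (∀ i, 0 ≤ p i) ∧ ∑ i, p i = 1 ∧
      ρ = spectralMatrix U p := by
  obtain ⟨U, hU, p, hp, rfl⟩ := hρ.1.exists_spectralMatrix
  have ht := hρ.2
  rw [trace_spectralMatrix hU] at ht
  exact ⟨U, hU, p, hp, by exact_mod_cast ht, rfl⟩

theorem isState_spectralMatrix (hU : U ∈ Matrix.unitaryGroup ι ℂ) {p : ι → ℝ}
    (hp : ∀ i, 0 ≤ p i) (hp1 : ∑ i, p i = 1) : IsState (spectralMatrix U p) :=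
  ⟨spectralMatrix_posSemidef hp, by rw [trace_spectralMatrix hU, hp1, Complex.ofReal_one]⟩

theorem traceNorm_spectralMatrix (hU : U ∈ Matrix.unitaryGroup ι ℂ) (d : ι → ℝ) :
    traceNorm (spectralMatrix U d) = ∑ i, |d i| := by
  rw [traceNorm, spectralMatrix_conjTranspose, spectralMatrix_mul hU, cfc_spectralMatrix hU,
    trace_spectralMatrix hU, Complex.ofReal_re]
  exact Finset.sum_congr rfl fun i _ => Real.sqrt_mul_self_eq_abs (d i)

theorem vonNeumannEntropy_spectralMatrix (hU : U ∈ Matrix.unitaryGroup ι ℂ) (p : ι → ℝ) :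
    vonNeumannEntropy (spectralMatrix U p) = ∑ i, -(p i * Real.logb 2 (p i)) := by
  rw [vonNeumannEntropy, cfc_spectralMatrix hU, trace_spectralMatrix hU, Complex.ofReal_re]
  rfl

/-- The sum of the `α`-th powers of the nonzero entries of `p`. -/
noncomputable def powerSum (α : ℝ) (p : ι → ℝ) : ℝ := ∑ i, if p i = 0 then 0 else p i ^ α

theorem renyiEntropy_spectralMatrix (α : ℝ) (hU : U ∈ Matrix.unitaryGroup ι ℂ) (p : ι → ℝ) :
    renyiEntropy α (spectralMatrix U p) = 1 / (1 - α) * Real.logb 2 (powerSum α p) := by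
  rw [renyiEntropy, cfc_spectralMatrix hU, trace_spectralMatrix hU, Complex.ofReal_re]
  rfl

theorem renyiEntropy_diagonal (α : ℝ) (p : ι → ℝ) :
    renyiEntropy α (Matrix.diagonal fun i => (p i : ℂ)) =
      1 / (1 - α) * Real.logb 2 (powerSum α p) := by
  rw [← spectralMatrix_one, renyiEntropy_spectralMatrix α (one_mem _)]

theorem isState_diagonal {p : ι → ℝ} (hp : ∀ i, 0 ≤ p i) (hp1 : ∑ i, p i = 1) :
    IsState (Matrix.diagonal fun i => (p i : ℂ)) := by
  rw [← spectralMatrix_one]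
  exact isState_spectralMatrix (one_mem _) hp hp1

end spectral

/-! ### Tensor powers of matrices. -/

section tensor

variable {ι : Type}

theorem tensorPower_mul [Fintype ι] (A B : Matrix ι ι ℂ) (n : ℕ) :
    tensorPower (A * B) n = tensorPower A n * tensorPower B n := by
  classical
  ext x y
  simp only [tensorPower, Matrix.of_apply, Matrix.mul_apply]
  rw [Finset.prod_univ_sum, Fintype.piFinset_univ]
  simp only [Finset.prod_mul_distrib]

theorem tensorPower_conjTranspose (A : Matrix ι ι ℂ) (n : ℕ) :
    tensorPower Aᴴ n = (tensorPower A n)ᴴ := by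
  ext x y
  simp [tensorPower, Matrix.conjTranspose_apply]

theorem tensorPower_diagonal [DecidableEq ι] (d : ι → ℂ) (n : ℕ) :
    tensorPower (Matrix.diagonal d) n = Matrix.diagonal fun x => ∏ i, d (x i) := by
  ext x y
  by_cases h : x = y
  · subst h
    simp [tensorPower]
  · obtain ⟨i, hi⟩ := Function.ne_iff.1 h
    rw [Matrix.diagonal_apply_ne _ h]
    exact Finset.prod_eq_zero (Finset.mem_univ i) (Matrix.diagonal_apply_ne _ hi)

variable [Fintype ι] [DecidableEq ι]

omit [Fintype ι] in
theorem tensorPower_one (n : ℕ) : tensorPower (1 : Matrix ι ι ℂ) n = 1 := by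
  rw [← Matrix.diagonal_one, tensorPower_diagonal]
  simp

theorem tensorPower_mem_unitaryGroup {U : Matrix ι ι ℂ} (hU : U ∈ Matrix.unitaryGroup ι ℂ)
    (n : ℕ) : tensorPower U n ∈ Matrix.unitaryGroup (Fin n → ι) ℂ := by
  rw [Matrix.mem_unitaryGroup_iff, Matrix.star_eq_conjTranspose, ← tensorPower_conjTranspose,
    ← tensorPower_mul, mul_conjTranspose_of_unitary hU, tensorPower_one]

theorem tensorPower_spectralMatrix (U : Matrix ι ι ℂ) (d : ι → ℝ) (n : ℕ) :
    tensorPower (spectralMatrix U d) n =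
      spectralMatrix (tensorPower U n) fun x => ∏ i, d (x i) := by
  simp only [spectralMatrix, tensorPower_mul, tensorPower_conjTranspose, tensorPower_diagonal,
    Complex.ofReal_prod]

end tensor

/-! ### Power sums of probability vectors. -/

section classical

variable {ι : Type} [Fintype ι] {α : ℝ} {p : ι → ℝ}

/-- The power sum as an expectation under `p`. The value 1 off the support carries no weight, and it
keeps the averaged quantity positive, as Jensen's inequality for the logarithm requires. -/
theorem powerSum_eq_sum_mul :
    powerSum α p = ∑ i, p i * (if p i = 0 then 1 else p i ^ (α - 1)) := by
  refine Finset.sum_congr rfl fun i _ => ?_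
  split_ifs with h
  · rw [h, zero_mul]
  · rw [Real.rpow_sub_one h, mul_div_cancel₀ _ h]

/-- Jensen's inequality for log applied to that expectation, since log p^(α-1) = -(1-α) log p.
Strict concavity makes equality mean that p^(α-1) is constant on the support. -/
theorem jensen_powerSum (hp : ∀ i, 0 ≤ p i) (hp1 : ∑ i, p i = 1) :
    (1 - α) * ∑ i, -(p i * Real.logb 2 (p i)) ≤ Real.logb 2 (powerSum α p) ∧
    ((1 - α) * ∑ i, -(p i * Real.logb 2 (p i)) = Real.logb 2 (powerSum α p) ↔
      ∀ i, p i ≠ 0 → p i ^ (α - 1) = powerSum α p) := by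
  set y : ι → ℝ := fun i => if p i = 0 then 1 else p i ^ (α - 1) with hy
  have hy0 : ∀ i ∈ Finset.univ, y i ∈ Set.Ioi (0 : ℝ) := by
    intro i _
    by_cases h : p i = 0
    · simp [hy, h]
    · simpa [hy, h] using Real.rpow_pos_of_pos (lt_of_le_of_ne (hp i) (Ne.symm h)) _
  have hs : ∑ i, p i • y i = powerSum α p := powerSum_eq_sum_mul.symm
  have hl : (∑ i, p i • Real.log (y i)) / Real.log 2 =
      (1 - α) * ∑ i, -(p i * Real.logb 2 (p i)) := by
    rw [Finset.sum_div, Finset.mul_sum]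
    refine Finset.sum_congr rfl fun i _ => ?_
    by_cases h : p i = 0
    · simp [h]
    · simp only [hy, h, if_false, smul_eq_mul, Real.logb]
      rw [Real.log_rpow (lt_of_le_of_ne (hp i) (Ne.symm h))]
      ring
  have hlog2 : 0 < Real.log 2 := Real.log_pos one_lt_two
  have h1 := strictConcaveOn_log_Ioi.concaveOn.le_map_sum (fun i _ => hp i) hp1 hy0
  have h2 := strictConcaveOn_log_Ioi.map_sum_eq_iff' (fun i _ => hp i) hp1 hy0
  rw [hs] at h1 h2
  rw [← hl, Real.logb]
  refine ⟨by gcongr, ?_⟩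
  rw [div_left_inj' hlog2.ne', eq_comm, h2]
  simp only [Finset.mem_univ, true_imp_iff]
  refine forall_congr' fun i => imp_congr_right fun h => ?_
  simp [hy, h]

/-- For α < 1 the power α-1 is injective on positive numbers, so the equality case says that the
spectrum is flat. The quadratic form of flatness lifts verbatim to ρ² = cρ. -/
theorem forall_rpow_eq_powerSum_iff (hp : ∀ i, 0 ≤ p i) (hp1 : ∑ i, p i = 1) (hα : α < 1) :
    (∀ i, p i ≠ 0 → p i ^ (α - 1) = powerSum α p) ↔ ∃ c : ℝ, ∀ i, p i * p i = c * p i := by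
  constructor
  · intro h
    refine ⟨powerSum α p ^ (α - 1)⁻¹, fun i => ?_⟩
    by_cases hi : p i = 0
    · simp [hi]
    · rw [← h i hi, Real.rpow_rpow_inv (hp i) (by linarith)]
  · rintro ⟨c, hc⟩ i hi
    have hc' (j : ι) (hj : p j ≠ 0) : p j = c := mul_right_cancel₀ hj (hc j)
    rw [powerSum_eq_sum_mul, hc' i hi]
    calc c ^ (α - 1) = ∑ j, p j * c ^ (α - 1) := by rw [← Finset.sum_mul, hp1, one_mul]
      _ = _ := Finset.sum_congr rfl fun j _ => by
        by_cases hj : p j = 0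
        · simp [hj]
        · rw [if_neg hj, hc' j hj]

theorem powerSum_mem_Icc {a b : ℝ} (hα : α < 1) (hp : ∀ i, 0 ≤ p i) (hp1 : ∑ i, p i = 1)
    (ha : 0 < a) (hab : ∀ i, p i ≠ 0 → a ≤ p i ∧ p i ≤ b) :
    b ^ (α - 1) ≤ powerSum α p ∧ powerSum α p ≤ a ^ (α - 1) := by
  have hc (c : ℝ) : c = ∑ i, p i * c := by rw [← Finset.sum_mul, hp1, one_mul]
  have hα' : α - 1 ≤ 0 := by linarith
  rw [powerSum_eq_sum_mul]
  constructor
  · rw [hc (b ^ (α - 1))]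
    refine Finset.sum_le_sum fun i _ => ?_
    split_ifs with h
    · simp [h]
    · exact mul_le_mul_of_nonneg_left (Real.rpow_le_rpow_of_nonpos
        (lt_of_lt_of_le ha (hab i h).1) (hab i h).2 hα') (hp i)
  · rw [hc (a ^ (α - 1))]
    refine Finset.sum_le_sum fun i _ => ?_
    split_ifs with h
    · simp [h]
    · exact mul_le_mul_of_nonneg_left (Real.rpow_le_rpow_of_nonpos ha (hab i h).1 hα') (hp i)

/-- An average of p^(α-1) lies between the extreme values of this decreasing function. After taking
logarithms the factor 1-α cancels, so the bounds do not depend on α. -/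
theorem logb_powerSum_mem_Icc {a b : ℝ} (hα : α < 1) (hp : ∀ i, 0 ≤ p i) (hp1 : ∑ i, p i = 1)
    (ha : 0 < a) (hb : 0 < b) (hab : ∀ i, p i ≠ 0 → a ≤ p i ∧ p i ≤ b) :
    -Real.logb 2 b ≤ 1 / (1 - α) * Real.logb 2 (powerSum α p) ∧
      1 / (1 - α) * Real.logb 2 (powerSum α p) ≤ -Real.logb 2 a := by
  obtain ⟨h1, h2⟩ := powerSum_mem_Icc hα hp hp1 ha hab
  have hα' : 0 < 1 - α := by linarith
  have hb' := Real.rpow_pos_of_pos hb (α - 1)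
  have h3 := Real.logb_le_logb_of_le one_lt_two hb' h1
  have h4 := Real.logb_le_logb_of_le one_lt_two (hb'.trans_le h1) h2
  rw [Real.logb_rpow_eq_mul_logb_of_pos hb] at h3
  rw [Real.logb_rpow_eq_mul_logb_of_pos ha] at h4
  rw [one_div_mul_eq_div, le_div_iff₀ hα', div_le_iff₀ hα']
  constructor <;> linarith

theorem le_one_of_sum_eq_one (hp : ∀ i, 0 ≤ p i) (hp1 : ∑ i, p i = 1) (i : ι) : p i ≤ 1 :=
  hp1 ▸ Finset.single_le_sum (fun j _ => hp j) (Finset.mem_univ i)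

theorem one_le_powerSum (hα : α < 1) (hp : ∀ i, 0 ≤ p i) (hp1 : ∑ i, p i = 1) :
    1 ≤ powerSum α p := by
  rw [powerSum_eq_sum_mul]
  refine hp1.symm.trans_le (Finset.sum_le_sum fun i _ => le_mul_of_one_le_right (hp i) ?_)
  split_ifs with h
  · exact le_rfl
  · exact Real.one_le_rpow_of_pos_of_le_one_of_nonpos (lt_of_le_of_ne (hp i) (Ne.symm h))
      (le_one_of_sum_eq_one hp hp1 i) (by linarith)

/-- Expand the power of a sum over strings. A product vanishes exactly when some factor does, so the
convention of dropping zeros is multiplicative too, even at α = 0. -/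
theorem powerSum_pi (hp : ∀ i, 0 ≤ p i) (n : ℕ) :
    powerSum α (fun x : Fin n → ι => ∏ i, p (x i)) = powerSum α p ^ n := by
  rw [powerSum, powerSum, Fintype.sum_pow]
  refine Finset.sum_congr rfl fun x _ => ?_
  split_ifs with h
  · obtain ⟨i, -, h0⟩ := Finset.prod_eq_zero_iff.1 h
    refine (Finset.prod_eq_zero (Finset.mem_univ i) ?_).symm
    exact if_pos h0
  · rw [← Real.finsetProd_rpow _ _ fun i _ => hp _]
    refine Finset.prod_congr rfl fun i _ => ?_
    rw [if_neg (Finset.prod_ne_zero_iff.1 h i (Finset.mem_univ i))]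

theorem sum_pi_prod (hp1 : ∑ i, p i = 1) (n : ℕ) : ∑ x : Fin n → ι, ∏ i, p (x i) = 1 := by
  rw [← Fintype.sum_pow, hp1, one_pow]

theorem sum_pi_succ {n : ℕ} (F : (Fin (n + 1) → ι) → ℝ) :
    ∑ x, F x = ∑ a, ∑ x : Fin n → ι, F (Fin.cons a x) := by
  rw [← Fintype.sum_prod_type' (f := fun a x => F (Fin.cons a x))]
  exact (Fintype.sum_equiv (Fin.consEquiv fun _ => ι) _ _ fun _ => rfl).symm

/-- Additivity of variance for independent centred variables: splitting off the first coordinate,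
the cross terms vanish because the means are zero. -/
theorem moments_pi (hp1 : ∑ i, p i = 1) {f : ι → ℝ} (hf : ∑ i, p i * f i = 0) (n : ℕ) :
    ∑ x : Fin n → ι, (∏ i, p (x i)) * ∑ i, f (x i) = 0 ∧
    ∑ x : Fin n → ι, (∏ i, p (x i)) * (∑ i, f (x i)) ^ 2 = n * ∑ i, p i * f i ^ 2 := by
  induction n with
  | zero => simp
  | succ n ih =>
    obtain ⟨ih1, ih2⟩ := ih
    have h0 := sum_pi_prod hp1 n
    simp only [sum_pi_succ, Fin.prod_univ_succ, Fin.sum_univ_succ, Fin.cons_zero, Fin.cons_succ]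
    constructor
    · have (a : ι) : ∑ x : Fin n → ι, p a * (∏ i, p (x i)) * (f a + ∑ i, f (x i)) = p a * f a := by
        calc _ = p a * f a * ∑ x : Fin n → ι, (∏ i, p (x i)) +
              p a * ∑ x : Fin n → ι, (∏ i, p (x i)) * ∑ i, f (x i) := by
              rw [Finset.mul_sum, Finset.mul_sum, ← Finset.sum_add_distrib]
              exact Finset.sum_congr rfl fun x _ => by ring
          _ = _ := by rw [h0, ih1]; ring
      rw [Finset.sum_congr rfl fun a _ => this a, hf]
    · have (a : ι) : ∑ x : Fin n → ι, p a * (∏ i, p (x i)) * (f a + ∑ i, f (x i)) ^ 2 =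
          p a * f a ^ 2 + p a * (n * ∑ i, p i * f i ^ 2) := by
        calc _ = p a * f a ^ 2 * ∑ x : Fin n → ι, (∏ i, p (x i)) +
              2 * p a * f a * (∑ x : Fin n → ι, (∏ i, p (x i)) * ∑ i, f (x i)) +
              p a * ∑ x : Fin n → ι, (∏ i, p (x i)) * (∑ i, f (x i)) ^ 2 := by
              rw [Finset.mul_sum, Finset.mul_sum, Finset.mul_sum, ← Finset.sum_add_distrib,
                ← Finset.sum_add_distrib]
              exact Finset.sum_congr rfl fun x _ => by ring
          _ = _ := by rw [h0, ih1, ih2]; ring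
      rw [Finset.sum_congr rfl fun a _ => this a, Finset.sum_add_distrib, ← Finset.sum_mul, hp1]
      push_cast
      ring

/-! ### Typical strings and the conditioned distribution. -/

/-- The Shannon entropy of `p`. -/
noncomputable def shannonEntropy (p : ι → ℝ) : ℝ := ∑ i, -(p i * Real.logb 2 (p i))

/-- The indicator function of the `δ`-typical probabilities of strings of length `n`. -/
noncomputable def typicalIndicator (S : ℝ) (n : ℕ) (δ : ℝ) : ℝ → ℝ :=
  (Set.Icc ((2 : ℝ) ^ (-((n : ℝ) * (S + δ)))) ((2 : ℝ) ^ (-((n : ℝ) * (S - δ))))).indicator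
    (fun _ : ℝ => (1 : ℝ))

/-- The total probability of the `δ`-typical strings. -/
noncomputable def typicalMass (p : ι → ℝ) (n : ℕ) (δ : ℝ) : ℝ :=
  ∑ x : Fin n → ι, typicalIndicator (shannonEntropy p) n δ (∏ i, p (x i)) * ∏ i, p (x i)

/-- The distribution of `n` samples of `p`, conditioned on the `δ`-typical strings. -/
noncomputable def typicalDistribution (p : ι → ℝ) (n : ℕ) (δ : ℝ) : (Fin n → ι) → ℝ :=
  fun x => (typicalMass p n δ)⁻¹ *
    (typicalIndicator (shannonEntropy p) n δ (∏ i, p (x i)) * ∏ i, p (x i))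

theorem typicalIndicator_eq_zero_or_one (S : ℝ) (n : ℕ) (δ x : ℝ) :
    typicalIndicator S n δ x = 0 ∨ typicalIndicator S n δ x = 1 :=
  Set.indicator_eq_zero_or_self _ _ _

theorem typicalIndicator_nonneg (S : ℝ) (n : ℕ) (δ x : ℝ) : 0 ≤ typicalIndicator S n δ x := by
  rcases typicalIndicator_eq_zero_or_one S n δ x with h | h <;> simp [h]

theorem typicalIndicator_le_one (S : ℝ) (n : ℕ) (δ x : ℝ) : typicalIndicator S n δ x ≤ 1 := by
  rcases typicalIndicator_eq_zero_or_one S n δ x with h | h <;> simp [h]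

theorem typicalIndicator_mul_self (S : ℝ) (n : ℕ) (δ x : ℝ) :
    typicalIndicator S n δ x * typicalIndicator S n δ x = typicalIndicator S n δ x := by
  rcases typicalIndicator_eq_zero_or_one S n δ x with h | h <;> simp [h]

theorem typicalIndicator_eq_one_of_abs_le {S δ x : ℝ} {n : ℕ} (hx : 0 < x)
    (h : |-Real.logb 2 x - n * S| ≤ n * δ) : typicalIndicator S n δ x = 1 := by
  rw [abs_le] at h
  apply Set.indicator_of_mem
  constructor
  · rw [← Real.le_logb_iff_rpow_le one_lt_two hx]
    linarith
  · rw [← Real.logb_le_iff_le_rpow one_lt_two hx]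
    linarith

/-- Chebyshev's inequality for -log of the probability of a string, a sum of n independent copies
with mean `shannonEntropy p`. An atypical string of positive probability deviates by more than nδ.
-/
theorem one_sub_typicalMass_le (hp : ∀ i, 0 ≤ p i) (hp1 : ∑ i, p i = 1) {n : ℕ} {δ : ℝ}
    (hδ : 0 < √(n : ℝ) * δ) :
    1 - typicalMass p n δ ≤
      (∑ i, p i * (-Real.logb 2 (p i) - shannonEntropy p) ^ 2) / (√(n : ℝ) * δ) ^ 2 := by
  set S := shannonEntropy p with hS
  set f : ι → ℝ := fun i => -Real.logb 2 (p i) - S with hf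
  set V := ∑ i, p i * f i ^ 2
  have hn : 0 < √(n : ℝ) := by
    rcases (Real.sqrt_nonneg (n : ℝ)).eq_or_lt with h | h
    · simp [← h] at hδ
    · exact h
  have hδ0 : 0 < δ := (mul_pos_iff_of_pos_left hn).1 hδ
  have hn0 : (0 : ℝ) < n := Real.sqrt_pos.1 hn
  have hsq : √(n : ℝ) ^ 2 = n := Real.sq_sqrt hn0.le
  have hf0 : ∑ i, p i * f i = 0 := by
    have : ∑ i, p i * f i = shannonEntropy p - (∑ i, p i) * S := by
      rw [shannonEntropy, Finset.sum_mul, ← Finset.sum_sub_distrib]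
      exact Finset.sum_congr rfl fun i _ => by simp only [hf]; ring
    rw [this, hp1, one_mul, sub_self]
  have key : (1 - typicalMass p n δ) * (n * δ) ^ 2 ≤ n * V := by
    rw [← (moments_pi hp1 hf0 n).2, ← sum_pi_prod hp1 n, typicalMass, ← Finset.sum_sub_distrib,
      Finset.sum_mul]
    refine Finset.sum_le_sum fun x _ => ?_
    have hP : 0 ≤ ∏ i, p (x i) := Finset.prod_nonneg fun _ _ => hp _
    rcases hP.eq_or_lt with h0 | hpos
    · simp [← h0]
    by_cases h : |-Real.logb 2 (∏ i, p (x i)) - n * S| ≤ n * δ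
    · rw [typicalIndicator_eq_one_of_abs_le hpos h]
      simp only [one_mul, sub_self, zero_mul]
      positivity
    · have hsum : ∑ i, f (x i) = -Real.logb 2 (∏ i, p (x i)) - n * S := by
        have hne : ∀ i ∈ Finset.univ, p (x i) ≠ 0 := Finset.prod_ne_zero_iff.1 hpos.ne'
        rw [Real.logb_prod _ _ hne]
        simp [hf, Finset.sum_sub_distrib]
      have hle : (n * δ) ^ 2 ≤ (∑ i, f (x i)) ^ 2 := by
        rw [hsum, sq_le_sq, abs_of_pos (by positivity : (0 : ℝ) < n * δ)]
        exact (not_le.1 h).le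
      have h1 := typicalIndicator_nonneg S n δ (∏ i, p (x i))
      -- On an atypical string the squared deviation alone pays for the whole probability, whatever
      -- the indicator is.
      calc _ ≤ (∏ i, p (x i)) * (n * δ) ^ 2 := by
            refine mul_le_mul_of_nonneg_right ?_ (sq_nonneg _)
            have := mul_nonneg h1 hP
            linarith
        _ ≤ _ := mul_le_mul_of_nonneg_left hle hP
  rw [le_div_iff₀ (by positivity), mul_pow, hsq]
  refine le_of_mul_le_mul_left ?_ hn0
  calc _ = (1 - typicalMass p n δ) * (n * δ) ^ 2 := by ring
    _ ≤ _ := key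

theorem typicalMass_le_one (hp : ∀ i, 0 ≤ p i) (hp1 : ∑ i, p i = 1) (n : ℕ) (δ : ℝ) :
    typicalMass p n δ ≤ 1 := by
  rw [← sum_pi_prod hp1 n]
  refine Finset.sum_le_sum fun x _ => mul_le_of_le_one_left
    (Finset.prod_nonneg fun _ _ => hp _) (typicalIndicator_le_one _ _ _ _)

theorem tendsto_typicalMass (hp : ∀ i, 0 ≤ p i) (hp1 : ∑ i, p i = 1) {δ : ℕ → ℝ}
    (hδ : Tendsto (fun n : ℕ => √(n : ℝ) * δ n) atTop atTop) :
    Tendsto (fun n => typicalMass p n (δ n)) atTop (𝓝 1) := by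
  have h1 : Tendsto (fun n => 1 - typicalMass p n (δ n)) atTop (𝓝 0) := by
    refine tendsto_of_tendsto_of_tendsto_of_le_of_le' tendsto_const_nhds
      (h := fun n : ℕ => (∑ i, p i * (-Real.logb 2 (p i) - shannonEntropy p) ^ 2) /
        (√(n : ℝ) * δ n) ^ 2) ?_
      (Eventually.of_forall fun n => sub_nonneg.2 (typicalMass_le_one hp hp1 n _)) ?_
    · exact tendsto_const_nhds.div_atTop ((tendsto_pow_atTop two_ne_zero).comp hδ)
    · filter_upwards [hδ.eventually_gt_atTop 0] with n hn using one_sub_typicalMass_le hp hp1 hn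
  simpa using h1.const_sub 1

theorem typicalDistribution_nonneg (hp : ∀ i, 0 ≤ p i) {n : ℕ} {δ : ℝ}
    (ht : 0 < typicalMass p n δ) (x : Fin n → ι) : 0 ≤ typicalDistribution p n δ x :=
  mul_nonneg (inv_nonneg.2 ht.le)
    (mul_nonneg (typicalIndicator_nonneg _ _ _ _) (Finset.prod_nonneg fun _ _ => hp _))

theorem sum_typicalDistribution {n : ℕ} {δ : ℝ} (ht : 0 < typicalMass p n δ) :
    ∑ x, typicalDistribution p n δ x = 1 := by
  simp only [typicalDistribution]
  rw [← Finset.mul_sum]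
  exact inv_mul_cancel₀ ht.ne'

/-- With t the typical mass, conditioning removes total weight 1-t from atypical strings and adds
the same amount to typical ones. -/
theorem sum_abs_sub_typicalDistribution (hp : ∀ i, 0 ≤ p i) (hp1 : ∑ i, p i = 1) {n : ℕ} {δ : ℝ}
    (ht : 0 < typicalMass p n δ) :
    ∑ x : Fin n → ι, |∏ i, p (x i) - typicalDistribution p n δ x| =
      2 * (1 - typicalMass p n δ) := by
  set t := typicalMass p n δ with htdef
  have ht1 : 1 ≤ t⁻¹ := (one_le_inv₀ ht).2 (typicalMass_le_one hp hp1 n δ)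
  have hterm (x : Fin n → ι) : |∏ i, p (x i) - typicalDistribution p n δ x| =
      ∏ i, p (x i) + (t⁻¹ - 2) *
        (typicalIndicator (shannonEntropy p) n δ (∏ i, p (x i)) * ∏ i, p (x i)) := by
    have hP : 0 ≤ ∏ i, p (x i) := Finset.prod_nonneg fun _ _ => hp _
    rw [typicalDistribution, ← htdef]
    rcases typicalIndicator_eq_zero_or_one (shannonEntropy p) n δ (∏ i, p (x i)) with h | h
    · simp [h, abs_of_nonneg hP]
    · rw [h, one_mul, abs_of_nonpos]
      · ring
      · have := mul_le_mul_of_nonneg_right ht1 hP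
        linarith
  rw [Finset.sum_congr rfl fun x _ => hterm x, Finset.sum_add_distrib, sum_pi_prod hp1,
    ← Finset.mul_sum]
  change 1 + (t⁻¹ - 2) * t = _
  have := inv_mul_cancel₀ ht.ne'
  linear_combination this

/-- Every nonzero conditioned probability is a typical one divided by the mass, so the α-independent
bounds on the entropy apply. -/
theorem logb_powerSum_typicalDistribution_mem (hα : α < 1) (hp : ∀ i, 0 ≤ p i) {n : ℕ} {δ : ℝ}
    (ht : 0 < typicalMass p n δ) :
    n * (shannonEntropy p - δ) + Real.logb 2 (typicalMass p n δ) ≤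
        1 / (1 - α) * Real.logb 2 (powerSum α (typicalDistribution p n δ)) ∧
      1 / (1 - α) * Real.logb 2 (powerSum α (typicalDistribution p n δ)) ≤
        n * (shannonEntropy p + δ) + Real.logb 2 (typicalMass p n δ) := by
  set t := typicalMass p n δ with htdef
  have hti := inv_pos.2 ht
  have hpow (s : ℝ) : (0 : ℝ) < 2 ^ s := Real.rpow_pos_of_pos two_pos s
  have := logb_powerSum_mem_Icc hα (typicalDistribution_nonneg hp ht) (sum_typicalDistribution ht)
    (a := t⁻¹ * 2 ^ (-((n : ℝ) * (shannonEntropy p + δ))))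
    (b := t⁻¹ * 2 ^ (-((n : ℝ) * (shannonEntropy p - δ))))
    (mul_pos hti (hpow _)) (mul_pos hti (hpow _)) (by
      intro x hx
      rw [typicalDistribution] at hx ⊢
      have hmem : ∏ i, p (x i) ∈ Set.Icc ((2 : ℝ) ^ (-((n : ℝ) * (shannonEntropy p + δ))))
          ((2 : ℝ) ^ (-((n : ℝ) * (shannonEntropy p - δ)))) :=
        Set.mem_of_indicator_ne_zero (left_ne_zero_of_mul (right_ne_zero_of_mul hx))
      have h1 : typicalIndicator (shannonEntropy p) n δ (∏ i, p (x i)) = 1 :=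
        Set.indicator_of_mem hmem _
      rw [h1, one_mul]
      exact ⟨mul_le_mul_of_nonneg_left hmem.1 hti.le, mul_le_mul_of_nonneg_left hmem.2 hti.le⟩)
  rw [Real.logb_mul hti.ne' (hpow _).ne', Real.logb_mul hti.ne' (hpow _).ne', Real.logb_inv,
    Real.logb_rpow two_pos (by norm_num), Real.logb_rpow two_pos (by norm_num)] at this
  constructor <;> linarith [this.1, this.2]

/-- After division by n the errors left are ±δ_n and (log of the typical mass)/n, both tending to 0.
-/
theorem tendsto_logb_powerSum_typicalDistribution (hα : α < 1) (hp : ∀ i, 0 ≤ p i)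
    (hp1 : ∑ i, p i = 1) {δ : ℕ → ℝ} (hδ : Tendsto (fun n : ℕ => √(n : ℝ) * δ n) atTop atTop)
    (hδ0 : Tendsto δ atTop (𝓝 0)) :
    Tendsto (fun n : ℕ =>
      1 / (1 - α) * Real.logb 2 (powerSum α (typicalDistribution p n (δ n))) / n) atTop
      (𝓝 (shannonEntropy p)) := by
  have ht := tendsto_typicalMass hp hp1 hδ
  have hlog : Tendsto (fun n : ℕ => Real.logb 2 (typicalMass p n (δ n)) / n) atTop (𝓝 0) := by
    refine Tendsto.div_atTop (a := Real.logb 2 1) ?_ tendsto_natCast_atTop_atTop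
    exact (Real.continuousAt_logb one_ne_zero).tendsto.comp ht
  have hlo : Tendsto (fun n : ℕ => shannonEntropy p - δ n +
      Real.logb 2 (typicalMass p n (δ n)) / n) atTop (𝓝 (shannonEntropy p)) := by
    simpa using (hδ0.const_sub (shannonEntropy p)).add hlog
  have hhi : Tendsto (fun n : ℕ => shannonEntropy p + δ n +
      Real.logb 2 (typicalMass p n (δ n)) / n) atTop (𝓝 (shannonEntropy p)) := by
    simpa using (hδ0.const_add (shannonEntropy p)).add hlog
  refine tendsto_of_tendsto_of_tendsto_of_le_of_le' hlo hhi ?_ ?_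
  · filter_upwards [ht.eventually_const_lt one_pos, eventually_gt_atTop 0] with n hn hn0
    have hn0 : (0 : ℝ) < n := Nat.cast_pos.2 hn0
    rw [le_div_iff₀ hn0]
    calc _ = n * (shannonEntropy p - δ n) + Real.logb 2 (typicalMass p n (δ n)) := by
          field_simp
      _ ≤ _ := (logb_powerSum_typicalDistribution_mem hα hp hn).1
  · filter_upwards [ht.eventually_const_lt one_pos, eventually_gt_atTop 0] with n hn hn0
    have hn0 : (0 : ℝ) < n := Nat.cast_pos.2 hn0
    rw [div_le_iff₀ hn0]
    calc _ ≤ n * (shannonEntropy p + δ n) + Real.logb 2 (typicalMass p n (δ n)) :=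
          (logb_powerSum_typicalDistribution_mem hα hp hn).2
      _ = _ := by field_simp

end classical

/-! ### Entropies and typical compressions of density matrices. -/

section mixed

variable {A : Type} [Fintype A] [DecidableEq A] {α : ℝ} {ρ : Matrix A A ℂ}

theorem renyiEntropy_nonneg (hα : α < 1) (hρ : IsState ρ) : 0 ≤ renyiEntropy α ρ := by
  obtain ⟨U, hU, p, hp, hp1, rfl⟩ := hρ.exists_spectralMatrix
  rw [renyiEntropy_spectralMatrix α hU]
  exact mul_nonneg (one_div_nonneg.2 (by linarith))
    (Real.logb_nonneg one_lt_two (one_le_powerSum hα hp hp1))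

theorem vonNeumannEntropy_le_renyiEntropy (hα : α < 1) (hρ : IsState ρ) :
    vonNeumannEntropy ρ ≤ renyiEntropy α ρ ∧
      (renyiEntropy α ρ = vonNeumannEntropy ρ ↔ ∃ c : ℝ, ρ * ρ = (c : ℂ) • ρ) := by
  obtain ⟨U, hU, p, hp, hp1, rfl⟩ := hρ.exists_spectralMatrix
  have hα' : 0 < 1 - α := by linarith
  obtain ⟨h1, h2⟩ := jensen_powerSum (α := α) hp hp1
  rw [forall_rpow_eq_powerSum_iff hp hp1 hα] at h2
  rw [renyiEntropy_spectralMatrix α hU, vonNeumannEntropy_spectralMatrix hU, one_div_mul_eq_div,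
    le_div_iff₀ hα', div_eq_iff hα'.ne', mul_comm _ (1 - α)]
  refine ⟨h1, eq_comm.trans (h2.trans (exists_congr fun c => ?_))⟩
  rw [spectralMatrix_mul hU, ← spectralMatrix_smul, (spectralMatrix_injective hU).eq_iff,
    funext_iff]
  rfl

theorem isState_tensorPower (hρ : IsState ρ) (n : ℕ) : IsState (tensorPower ρ n) := by
  obtain ⟨U, hU, p, hp, hp1, rfl⟩ := hρ.exists_spectralMatrix
  rw [tensorPower_spectralMatrix]
  exact isState_spectralMatrix (tensorPower_mem_unitaryGroup hU n)
    (fun x => Finset.prod_nonneg fun _ _ => hp _) (sum_pi_prod hp1 n)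

theorem renyiEntropy_tensorPower (hρ : IsState ρ) (n : ℕ) :
    renyiEntropy α (tensorPower ρ n) = n * renyiEntropy α ρ := by
  obtain ⟨U, hU, p, hp, hp1, rfl⟩ := hρ.exists_spectralMatrix
  rw [tensorPower_spectralMatrix, renyiEntropy_spectralMatrix α (tensorPower_mem_unitaryGroup hU n),
    renyiEntropy_spectralMatrix α hU, powerSum_pi hp, Real.logb_pow]
  ring

variable {U : Matrix A A ℂ} {p : A → ℝ}

theorem typicalProjection_spectralMatrix (hU : U ∈ Matrix.unitaryGroup A ℂ) (n : ℕ) (δ : ℝ) :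
    typicalProjection (spectralMatrix U p) n δ = spectralMatrix (tensorPower U n)
      (fun x => typicalIndicator (shannonEntropy p) n δ (∏ i, p (x i))) := by
  rw [typicalProjection, tensorPower_spectralMatrix,
    cfc_spectralMatrix (tensorPower_mem_unitaryGroup hU n), vonNeumannEntropy_spectralMatrix hU]
  rfl

theorem trace_typicalProjection_mul (hU : U ∈ Matrix.unitaryGroup A ℂ) (n : ℕ) (δ : ℝ) :
    (typicalProjection (spectralMatrix U p) n δ * tensorPower (spectralMatrix U p) n).trace =
      (typicalMass p n δ : ℂ) := by
  have hUn := tensorPower_mem_unitaryGroup hU n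
  rw [typicalProjection_spectralMatrix hU, tensorPower_spectralMatrix, spectralMatrix_mul hUn,
    trace_spectralMatrix hUn]
  rfl

theorem typicalState_spectralMatrix (hU : U ∈ Matrix.unitaryGroup A ℂ) (n : ℕ) (δ : ℝ) :
    typicalState (spectralMatrix U p) n δ =
      spectralMatrix (tensorPower U n) (typicalDistribution p n δ) := by
  have hUn := tensorPower_mem_unitaryGroup hU n
  rw [typicalState, compress, trace_typicalProjection_mul hU, typicalProjection_spectralMatrix hU,
    tensorPower_spectralMatrix, spectralMatrix_mul hUn, spectralMatrix_mul hUn,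
    ← Complex.ofReal_inv, ← spectralMatrix_smul]
  congr 1
  ext x
  simp only [Pi.smul_apply, Pi.mul_apply, smul_eq_mul, typicalDistribution]
  rw [mul_right_comm, typicalIndicator_mul_self]

theorem typicalProjection_conjTranspose (hρ : IsState ρ) (n : ℕ) (δ : ℝ) :
    (typicalProjection ρ n δ)ᴴ = typicalProjection ρ n δ := by
  obtain ⟨U, hU, p, hp, hp1, rfl⟩ := hρ.exists_spectralMatrix
  rw [typicalProjection_spectralMatrix hU, spectralMatrix_conjTranspose]

theorem typicalProjection_mul_self (hρ : IsState ρ) (n : ℕ) (δ : ℝ) :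
    typicalProjection ρ n δ * typicalProjection ρ n δ = typicalProjection ρ n δ := by
  obtain ⟨U, hU, p, hp, hp1, rfl⟩ := hρ.exists_spectralMatrix
  rw [typicalProjection_spectralMatrix hU, spectralMatrix_mul (tensorPower_mem_unitaryGroup hU n)]
  congr 1
  ext x
  exact typicalIndicator_mul_self _ _ _ _

theorem exists_trace_typicalProjection_mul (hρ : IsState ρ) {δ : ℕ → ℝ}
    (hδ : Tendsto (fun n : ℕ => √(n : ℝ) * δ n) atTop atTop) :
    ∃ t : ℕ → ℝ, Tendsto t atTop (𝓝 1) ∧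
      ∀ n, (typicalProjection ρ n (δ n) * tensorPower ρ n).trace = (t n : ℂ) := by
  obtain ⟨U, hU, p, hp, hp1, rfl⟩ := hρ.exists_spectralMatrix
  exact ⟨_, tendsto_typicalMass hp hp1 hδ, fun n => trace_typicalProjection_mul hU n (δ n)⟩

theorem typicalState_convergence (hα : α < 1) (hρ : IsState ρ) {δ : ℕ → ℝ}
    (hδ : Tendsto (fun n : ℕ => √(n : ℝ) * δ n) atTop atTop) :
    (∀ᶠ n in atTop, IsState (typicalState ρ n (δ n))) ∧
      Tendsto (fun n => traceNorm (tensorPower ρ n - typicalState ρ n (δ n))) atTop (𝓝 0) ∧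
      (Tendsto δ atTop (𝓝 0) →
        Tendsto (fun n : ℕ => renyiEntropy α (typicalState ρ n (δ n)) / n)
          atTop (𝓝 (vonNeumannEntropy ρ))) := by
  obtain ⟨U, hU, p, hp, hp1, rfl⟩ := hρ.exists_spectralMatrix
  have ht := tendsto_typicalMass hp hp1 hδ
  have hev := ht.eventually_const_lt one_pos
  refine ⟨?_, ?_, fun hδ0 => ?_⟩
  · filter_upwards [hev] with n hn
    rw [typicalState_spectralMatrix hU]
    exact isState_spectralMatrix (tensorPower_mem_unitaryGroup hU n)
      (typicalDistribution_nonneg hp hn) (sum_typicalDistribution hn)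
  · have h0 : Tendsto (fun n => 2 * (1 - typicalMass p n (δ n))) atTop (𝓝 0) := by
      simpa using (ht.const_sub 1).const_mul 2
    refine h0.congr' ?_
    filter_upwards [hev] with n hn
    rw [typicalState_spectralMatrix hU, tensorPower_spectralMatrix, ← spectralMatrix_sub,
      traceNorm_spectralMatrix (tensorPower_mem_unitaryGroup hU n),
      ← sum_abs_sub_typicalDistribution hp hp1 hn]
    rfl
  · rw [vonNeumannEntropy_spectralMatrix hU]
    refine (tendsto_logb_powerSum_typicalDistribution hα hp hp1 hδ hδ0).congr fun n => ?_
    rw [typicalState_spectralMatrix hU,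
      renyiEntropy_spectralMatrix α (tensorPower_mem_unitaryGroup hU n)]

theorem tendsto_renyiEntropy_sub_typicalState (hα : α < 1) (hρ : IsState ρ) {δ : ℕ → ℝ}
    (hδ : Tendsto (fun n : ℕ => √(n : ℝ) * δ n) atTop atTop) (hδ0 : Tendsto δ atTop (𝓝 0)) :
    Tendsto (fun n : ℕ => (renyiEntropy α (tensorPower ρ n) -
      renyiEntropy α (typicalState ρ n (δ n))) / n)
      atTop (𝓝 (renyiEntropy α ρ - vonNeumannEntropy ρ)) := by
  refine (((typicalState_convergence hα hρ hδ).2.2 hδ0).const_sub (renyiEntropy α ρ)).congr' ?_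
  filter_upwards [eventually_gt_atTop 0] with n hn
  have hn0 : (n : ℝ) ≠ 0 := Nat.cast_ne_zero.2 hn.ne'
  rw [renyiEntropy_tensorPower hρ, sub_div, mul_div_cancel_left₀ _ hn0]

end mixed

/-! ### Overlaps and trace distance of pure states. -/

section pure

variable {ι : Type} [Fintype ι]

theorem trace_pureState (ψ : ι → ℂ) : (pureState ψ).trace = ((∑ i, ‖ψ i‖ ^ 2 : ℝ) : ℂ) := by
  rw [pureState, Matrix.trace_vecMulVec, Complex.ofReal_sum]
  refine Finset.sum_congr rfl fun i _ => ?_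
  rw [Pi.star_apply, RCLike.star_def, Complex.mul_conj']
  norm_cast

theorem isUnitVector_iff_trace (ψ : ι → ℂ) : IsUnitVector ψ ↔ (pureState ψ).trace = 1 := by
  rw [trace_pureState, IsUnitVector]
  norm_cast

theorem pureState_posSemidef (ψ : ι → ℂ) : (pureState ψ).PosSemidef :=
  Matrix.posSemidef_vecMulVec_self_star ψ

theorem isState_pureState [DecidableEq ι] {ψ : ι → ℂ} (hψ : IsUnitVector ψ) :
    IsState (pureState ψ) :=
  ⟨pureState_posSemidef ψ, (isUnitVector_iff_trace ψ).1 hψ⟩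

theorem pureState_mul_mul_pureState (ψ : ι → ℂ) (X : Matrix ι ι ℂ) :
    pureState ψ * X * pureState ψ = (X * pureState ψ).trace • pureState ψ := by
  rw [Matrix.mul_assoc, pureState, Matrix.mul_vecMulVec X ψ, Matrix.trace_vecMulVec,
    Matrix.vecMulVec_mul_vecMulVec, dotProduct_comm, Matrix.vecMulVec_smul]

theorem conj_pureState (X : Matrix ι ι ℂ) (ψ : ι → ℂ) :
    X * pureState ψ * Xᴴ = pureState (X *ᵥ ψ) := by
  rw [pureState, pureState, Matrix.mul_vecMulVec, Matrix.vecMulVec_mul, Matrix.star_mulVec]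

omit [Fintype ι] in
theorem pureState_smul (c : ℝ) (ψ : ι → ℂ) :
    pureState ((c : ℂ) • ψ) = ((c ^ 2 : ℝ) : ℂ) • pureState ψ := by
  ext i j
  simp [pureState, Matrix.vecMulVec_apply]
  ring

theorem trace_pureState_mul_pureState (ψ φ : ι → ℂ) :
    (pureState ψ * pureState φ).trace = ((‖star ψ ⬝ᵥ φ‖ ^ 2 : ℝ) : ℂ) := by
  rw [pureState, pureState, Matrix.vecMulVec_mul_vecMulVec, Matrix.trace_vecMulVec,
    Complex.ofReal_pow, ← Complex.mul_conj']
  have : (starRingEnd ℂ) (star ψ ⬝ᵥ φ) = ψ ⬝ᵥ star φ := by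
    rw [← RCLike.star_def, ← Matrix.star_dotProduct_star, star_star, dotProduct_comm]
  rw [this, dotProduct_smul, smul_eq_mul]

variable [DecidableEq ι] {ψ φ : ι → ℂ}

theorem pureState_mul_self (hψ : IsUnitVector ψ) : pureState ψ * pureState ψ = pureState ψ := by
  have := pureState_mul_mul_pureState ψ 1
  rwa [Matrix.mul_one, Matrix.one_mul, (isUnitVector_iff_trace ψ).1 hψ, one_smul] at this

/-- The squared Hilbert–Schmidt distance. Its positivity gives Cauchy–Schwarz, and its vanishing
gives the equality case. -/
theorem trace_sub_sq (hψ : IsUnitVector ψ) (hφ : IsUnitVector φ) :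
    ((pureState ψ - pureState φ)ᴴ * (pureState ψ - pureState φ)).trace =
      ((2 * (1 - ‖star ψ ⬝ᵥ φ‖ ^ 2) : ℝ) : ℂ) := by
  rw [((pureState_posSemidef ψ).isHermitian.sub (pureState_posSemidef φ).isHermitian).eq]
  simp only [Matrix.sub_mul, Matrix.mul_sub, Matrix.trace_sub, pureState_mul_self hψ,
    pureState_mul_self hφ, (isUnitVector_iff_trace _).1 hψ, (isUnitVector_iff_trace _).1 hφ,
    Matrix.trace_mul_comm (pureState φ), trace_pureState_mul_pureState ψ φ]
  push_cast
  ring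

theorem norm_dotProduct_sq_le_one (hψ : IsUnitVector ψ) (hφ : IsUnitVector φ) :
    ‖star ψ ⬝ᵥ φ‖ ^ 2 ≤ 1 := by
  have h := (Matrix.posSemidef_conjTranspose_mul_self (pureState ψ - pureState φ)).trace_nonneg
  rw [trace_sub_sq hψ hφ] at h
  have := Complex.zero_le_real.1 h
  linarith

theorem pureState_eq_of_norm_dotProduct_sq (hψ : IsUnitVector ψ) (hφ : IsUnitVector φ)
    (h : ‖star ψ ⬝ᵥ φ‖ ^ 2 = 1) : pureState φ = pureState ψ := by
  have h0 := trace_sub_sq hψ hφ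
  rw [h, sub_self, mul_zero, Complex.ofReal_zero, Matrix.trace_conjTranspose_mul_self_eq_zero_iff,
    sub_eq_zero] at h0
  exact h0.symm

/-- For the difference M of the two projections, PQP = |⟨ψ,φ⟩|²P and its mirror image give M³ = sM.
Hence M² has eigenvalues 0 and s only; they sum to 2s, so their square roots sum to 2√s. -/
theorem traceNorm_pureState_sub (hψ : IsUnitVector ψ) (hφ : IsUnitVector φ) :
    traceNorm (pureState ψ - pureState φ) = 2 * √(1 - ‖star ψ ⬝ᵥ φ‖ ^ 2) := by
  set s := 1 - ‖star ψ ⬝ᵥ φ‖ ^ 2 with hs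
  have hs0 : 0 ≤ s := sub_nonneg.2 (norm_dotProduct_sq_le_one hψ hφ)
  set M := pureState ψ - pureState φ with hM
  have htr : (Mᴴ * M).trace = ((2 * s : ℝ) : ℂ) := trace_sub_sq hψ hφ
  have hH : Mᴴ = M :=
    ((pureState_posSemidef ψ).isHermitian.sub (pureState_posSemidef φ).isHermitian).eq
  have hPQP := pureState_mul_mul_pureState ψ (pureState φ)
  have hQPQ := pureState_mul_mul_pureState φ (pureState ψ)
  rw [Matrix.trace_mul_comm, trace_pureState_mul_pureState] at hPQP
  rw [trace_pureState_mul_pureState] at hQPQ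
  have hcube : M * M * M = (s : ℂ) • M := by
    have hP := pureState_mul_self hψ
    have hQ := pureState_mul_self hφ
    rw [hM, hs]
    simp only [Matrix.sub_mul, Matrix.mul_sub, hP, hQ, hPQP, hQPQ]
    simp only [hP, hQ, Matrix.mul_assoc]
    push_cast
    module
  obtain ⟨U, hU, d, hd, hN⟩ := (Matrix.posSemidef_conjTranspose_mul_self M).exists_spectralMatrix
  have hsq (i : ι) : d i * d i = s * d i := by
    have h1 : Mᴴ * M * (Mᴴ * M) = (s : ℂ) • (Mᴴ * M) := by
      rw [hH, ← Matrix.mul_assoc, hcube, Matrix.smul_mul]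
    rw [hN, spectralMatrix_mul hU, ← spectralMatrix_smul] at h1
    exact congrFun (spectralMatrix_injective hU h1) i
  rw [hN, trace_spectralMatrix hU] at htr
  have hsum : ∑ i, d i = 2 * s := by exact_mod_cast htr
  have hroot (i : ι) : √s * √(d i) = d i := by
    rw [← Real.sqrt_mul hs0, ← hsq, Real.sqrt_mul_self (hd i)]
  rw [traceNorm, hN, cfc_spectralMatrix hU, trace_spectralMatrix hU, Complex.ofReal_re]
  change ∑ i, √(d i) = _
  rcases hs0.eq_or_lt with h | h
  · have hd0 (i : ι) : d i = 0 := by simpa [← h] using hsq i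
    simp [hd0, ← h]
  · refine mul_left_cancel₀ (Real.sqrt_pos.2 h).ne' ?_
    rw [Finset.mul_sum, Finset.sum_congr rfl fun i _ => hroot i, hsum]
    linear_combination -2 * Real.mul_self_sqrt hs0

end pure

/-! ### Partial trace and local operators. -/

section reduction

variable {A B : Type} [Fintype A] [Fintype B]

theorem trace_reduceA (ρ : Matrix (A × B) (A × B) ℂ) : (reduceA ρ).trace = ρ.trace := by
  simp [reduceA, Matrix.trace, Fintype.sum_prod_type]

omit [Fintype A] in
theorem reduceA_smul (c : ℂ) (ρ : Matrix (A × B) (A × B) ℂ) :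
    reduceA (c • ρ) = c • reduceA ρ := by
  ext a a'
  simp [reduceA, Finset.mul_sum]

theorem reduceA_kronecker_mul [DecidableEq B] (P : Matrix A A ℂ) (ρ : Matrix (A × B) (A × B) ℂ) :
    reduceA ((P ⊗ₖ (1 : Matrix B B ℂ)) * ρ) = P * reduceA ρ := by
  ext a a'
  simp only [reduceA, Matrix.of_apply, Matrix.mul_apply, Fintype.sum_prod_type,
    Matrix.kronecker_apply, Matrix.one_apply, mul_ite, mul_one, mul_zero, ite_mul, zero_mul,
    Finset.sum_ite_eq, Finset.mem_univ, if_true]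
  rw [Finset.sum_comm]
  simp only [Finset.mul_sum]

theorem reduceA_mul_kronecker [DecidableEq B] (P : Matrix A A ℂ) (ρ : Matrix (A × B) (A × B) ℂ) :
    reduceA (ρ * (P ⊗ₖ (1 : Matrix B B ℂ))) = reduceA ρ * P := by
  ext a a'
  simp only [reduceA, Matrix.of_apply, Matrix.mul_apply, Fintype.sum_prod_type,
    Matrix.kronecker_apply, Matrix.one_apply, mul_ite, mul_one, mul_zero,
    Finset.sum_ite_eq', Finset.mem_univ, if_true]
  rw [Finset.sum_comm]
  simp only [Finset.sum_mul]

theorem trace_kronecker_mul [DecidableEq B] (P : Matrix A A ℂ) (ρ : Matrix (A × B) (A × B) ℂ) :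
    ((P ⊗ₖ (1 : Matrix B B ℂ)) * ρ).trace = (P * reduceA ρ).trace := by
  rw [← trace_reduceA, reduceA_kronecker_mul]

omit [Fintype A] in
theorem reduceA_pureState (ψ : A × B → ℂ) :
    reduceA (pureState ψ) =
      (Matrix.of fun a b => ψ (a, b)) * (Matrix.of fun a b => ψ (a, b))ᴴ := by
  ext a a'
  simp [reduceA, pureState, Matrix.vecMulVec_apply, Matrix.mul_apply]

theorem isState_reduceA_pureState [DecidableEq A] {ψ : A × B → ℂ} (hψ : IsUnitVector ψ) :
    IsState (reduceA (pureState ψ)) := by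
  refine ⟨?_, ?_⟩
  · rw [reduceA_pureState]
    exact Matrix.posSemidef_self_mul_conjTranspose _
  · rw [trace_reduceA, (isUnitVector_iff_trace ψ).1 hψ]

omit [Fintype A] in
theorem reduceA_pureState_bipartitePower (ψ : A × B → ℂ) (n : ℕ) :
    reduceA (pureState (bipartitePower ψ n)) = tensorPower (reduceA (pureState ψ)) n := by
  classical
  ext x y
  simp only [reduceA, tensorPower, pureState, Matrix.vecMulVec_apply, Matrix.of_apply,
    bipartitePower, Pi.star_apply, star_prod]
  rw [Finset.prod_univ_sum, Fintype.piFinset_univ]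
  simp only [Finset.prod_mul_distrib]

theorem isUnitVector_bipartitePower [DecidableEq A] {ψ : A × B → ℂ} (hψ : IsUnitVector ψ)
    (n : ℕ) : IsUnitVector (bipartitePower ψ n) := by
  rw [isUnitVector_iff_trace, ← trace_reduceA, reduceA_pureState_bipartitePower]
  exact (isState_tensorPower (isState_reduceA_pureState hψ) n).2

end reduction

/-! ### The convex roof and the bipartite witness. -/

section roof

variable {A B : Type} [Fintype A] [DecidableEq A] [Fintype B] [DecidableEq B] {α : ℝ}

/-- The average entropies of the pure-state ensembles of `ρ`. -/
def ensembleEntropies (α : ℝ) (ρ : Matrix (A × B) (A × B) ℂ) : Set ℝ :=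
  {e : ℝ | ∃ (k : ℕ) (p : Fin k → ℝ) (ψ : Fin k → A × B → ℂ),
    (∀ i, 0 ≤ p i) ∧ ∑ i, p i = 1 ∧ (∀ i, IsUnitVector (ψ i)) ∧
    ρ = ∑ i, p i • pureState (ψ i) ∧
    e = ∑ i, p i * renyiEntropy α (reduceA (pureState (ψ i)))}

omit [DecidableEq B] in
-- Reindexing admits any finite index type, in particular eigenbases and disjoint unions of
-- ensembles.
theorem mem_ensembleEntropies {κ : Type} [Fintype κ] {ρ : Matrix (A × B) (A × B) ℂ} {p : κ → ℝ}
    {ψ : κ → A × B → ℂ} (hp : ∀ i, 0 ≤ p i) (hp1 : ∑ i, p i = 1) (hψ : ∀ i, IsUnitVector (ψ i))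
    (hρ : ρ = ∑ i, p i • pureState (ψ i)) :
    ∑ i, p i * renyiEntropy α (reduceA (pureState (ψ i))) ∈ ensembleEntropies α ρ := by
  let e := (Fintype.equivFin κ).symm
  refine ⟨Fintype.card κ, p ∘ e, ψ ∘ e, fun i => hp _, ?_, fun i => hψ _, ?_, ?_⟩
  · rw [← hp1, ← e.sum_comp]
    rfl
  · rw [hρ, ← e.sum_comp]
    rfl
  · rw [← e.sum_comp]
    rfl

omit [DecidableEq B] in
theorem ensembleEntropies_nonneg (hα : α < 1) {ρ : Matrix (A × B) (A × B) ℂ} {e : ℝ}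
    (he : e ∈ ensembleEntropies α ρ) : 0 ≤ e := by
  obtain ⟨k, p, ψ, hp, -, hψ, -, rfl⟩ := he
  exact Finset.sum_nonneg fun i _ =>
    mul_nonneg (hp i) (renyiEntropy_nonneg hα (isState_reduceA_pureState (hψ i)))

omit [DecidableEq B] in
theorem bddBelow_ensembleEntropies (hα : α < 1) (ρ : Matrix (A × B) (A × B) ℂ) :
    BddBelow (ensembleEntropies α ρ) :=
  ⟨0, fun _ he => ensembleEntropies_nonneg hα he⟩

theorem renyiRoof_le (hα : α < 1) {ρ : Matrix (A × B) (A × B) ℂ} {e : ℝ}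
    (he : e ∈ ensembleEntropies α ρ) : renyiRoof α A B ρ ≤ e :=
  csInf_le (bddBelow_ensembleEntropies hα ρ) he

theorem spectralMatrix_eq_sum_pureState {ι : Type} [Fintype ι] [DecidableEq ι] (U : Matrix ι ι ℂ)
    (p : ι → ℝ) : spectralMatrix U p = ∑ i, p i • pureState (Uᵀ i) := by
  ext a b
  rw [spectralMatrix, Matrix.mul_apply, Matrix.sum_apply]
  refine Finset.sum_congr rfl fun i _ => ?_
  simp [pureState, Matrix.vecMulVec_apply, Matrix.mul_diagonal]
  ring

theorem isUnitVector_column {ι : Type} [Fintype ι] [DecidableEq ι] {U : Matrix ι ι ℂ}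
    (hU : U ∈ Matrix.unitaryGroup ι ℂ) (i : ι) : IsUnitVector (Uᵀ i) := by
  have h := congrFun (congrFun (conjTranspose_mul_of_unitary hU) i) i
  rw [isUnitVector_iff_trace, pureState, Matrix.trace_vecMulVec, ← Matrix.one_apply_eq i, ← h,
    dotProduct_comm]
  rfl

/-- The eigenvector ensemble is a witness. Without one, the infimum would be the default value of
`sInf` on the empty set. -/
theorem ensembleEntropies_nonempty {ρ : Matrix (A × B) (A × B) ℂ} (hρ : IsState ρ) :
    (ensembleEntropies α ρ).Nonempty := by
  obtain ⟨U, hU, p, hp, hp1, rfl⟩ := hρ.exists_spectralMatrix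
  exact ⟨_, mem_ensembleEntropies hp hp1 (isUnitVector_column hU)
    (spectralMatrix_eq_sum_pureState U p)⟩

/-- Pure states are extreme: the squared overlaps with φ average to 1 and each is at most 1, so each
one of positive weight equals 1. -/
theorem pureState_eq_of_ensemble {ι κ : Type} [Fintype ι] [DecidableEq ι] [Fintype κ]
    {φ : ι → ℂ} {p : κ → ℝ} {ψ : κ → ι → ℂ} (hφ : IsUnitVector φ) (hp : ∀ i, 0 ≤ p i)
    (hp1 : ∑ i, p i = 1) (hψ : ∀ i, IsUnitVector (ψ i))
    (h : pureState φ = ∑ i, p i • pureState (ψ i)) {i : κ} (hi : p i ≠ 0) :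
    pureState (ψ i) = pureState φ := by
  refine pureState_eq_of_norm_dotProduct_sq hφ (hψ i) ?_
  have htr : (1 : ℂ) = ((∑ j, p j * ‖star φ ⬝ᵥ ψ j‖ ^ 2 : ℝ) : ℂ) := by
    calc (1 : ℂ) = (pureState φ * pureState φ).trace := by
          rw [pureState_mul_self hφ, (isUnitVector_iff_trace φ).1 hφ]
      _ = (pureState φ * ∑ j, p j • pureState (ψ j)).trace := by rw [← h]
      _ = _ := by
          rw [Finset.mul_sum, Matrix.trace_sum, Complex.ofReal_sum]
          refine Finset.sum_congr rfl fun j _ => ?_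
          rw [Matrix.mul_smul, Matrix.trace_smul, trace_pureState_mul_pureState,
            Complex.real_smul, Complex.ofReal_mul]
  have hsum : ∑ j, p j * (1 - ‖star φ ⬝ᵥ ψ j‖ ^ 2) = 0 := by
    have : ∑ j, p j * ‖star φ ⬝ᵥ ψ j‖ ^ 2 = 1 := by exact_mod_cast htr.symm
    simp only [mul_sub, mul_one, Finset.sum_sub_distrib, hp1, this, sub_self]
  have h0 := (Finset.sum_eq_zero_iff_of_nonneg fun j _ =>
    mul_nonneg (hp j) (sub_nonneg.2 (norm_dotProduct_sq_le_one hφ (hψ j)))).1 hsum i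
    (Finset.mem_univ i)
  linarith [(mul_eq_zero.1 h0).resolve_left hi]

theorem renyiRoof_pureState {φ : A × B → ℂ} (hφ : IsUnitVector φ) :
    renyiRoof α A B (pureState φ) = renyiEntropy α (reduceA (pureState φ)) := by
  have h : ensembleEntropies α (pureState φ) = {renyiEntropy α (reduceA (pureState φ))} := by
    refine Set.eq_singleton_iff_unique_mem.2 ⟨?_, ?_⟩
    · have := mem_ensembleEntropies (α := α) (κ := Unit) (ρ := pureState φ) (p := fun _ => 1)
        (ψ := fun _ => φ) (fun _ => zero_le_one) (by simp) (fun _ => hφ) (by simp)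
      simpa using this
    · rintro e ⟨k, p, ψ, hp, hp1, hψ, h, rfl⟩
      rw [← one_mul (renyiEntropy α _), ← hp1, Finset.sum_mul]
      refine Finset.sum_congr rfl fun i _ => ?_
      by_cases hi : p i = 0
      · simp [hi]
      · rw [pureState_eq_of_ensemble hφ hp hp1 hψ h hi]
  change sInf (ensembleEntropies α (pureState φ)) = _
  rw [h, csInf_singleton]

omit [DecidableEq B] in
theorem add_mem_ensembleEntropies {ρ σ : Matrix (A × B) (A × B) ℂ} {a b e f : ℝ} (ha : 0 ≤ a)
    (hb : 0 ≤ b) (hab : a + b = 1) (he : e ∈ ensembleEntropies α ρ)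
    (hf : f ∈ ensembleEntropies α σ) :
    a * e + b * f ∈ ensembleEntropies α (a • ρ + b • σ) := by
  obtain ⟨k, p, ψ, hp, hp1, hψ, rfl, rfl⟩ := he
  obtain ⟨l, q, φ, hq, hq1, hφ, rfl, rfl⟩ := hf
  have := mem_ensembleEntropies (α := α) (κ := Fin k ⊕ Fin l)
    (ρ := a • ∑ i, p i • pureState (ψ i) + b • ∑ i, q i • pureState (φ i))
    (p := Sum.elim (a • p) (b • q)) (ψ := Sum.elim ψ φ)
    (by rintro (i | i)
        · exact mul_nonneg ha (hp i)
        · exact mul_nonneg hb (hq i))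
    (by simp [← Finset.mul_sum, hp1, hq1, hab])
    (by rintro (i | i)
        · exact hψ i
        · exact hφ i)
    (by simp [Finset.smul_sum, mul_smul])
  simpa [Finset.mul_sum, mul_assoc] using this

theorem convex_setOf_isState {ι : Type} [Fintype ι] [DecidableEq ι] :
    Convex ℝ {ρ : Matrix ι ι ℂ | IsState ρ} := by
  intro ρ hρ σ hσ a b ha hb hab
  refine ⟨(hρ.1.smul ha).add (hσ.1.smul hb), ?_⟩
  rw [Matrix.trace_add, Matrix.trace_smul, Matrix.trace_smul, hρ.2, hσ.2, ← add_smul, hab,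
    one_smul]

/-- The weighted union of nearly optimal ensembles of ρ and σ is an ensemble of the mixture. -/
theorem convexOn_renyiRoof (hα : α < 1) :
    ConvexOn ℝ {ρ : Matrix (A × B) (A × B) ℂ | IsState ρ} (renyiRoof α A B) := by
  refine ⟨convex_setOf_isState, fun ρ hρ σ hσ a b ha hb hab => le_of_forall_pos_le_add ?_⟩
  intro ε hε
  obtain ⟨e, he, he'⟩ := exists_lt_of_csInf_lt (ensembleEntropies_nonempty (α := α) hρ)
    (lt_add_of_pos_right (renyiRoof α A B ρ) hε)
  obtain ⟨f, hf, hf'⟩ := exists_lt_of_csInf_lt (ensembleEntropies_nonempty (α := α) hσ)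
    (lt_add_of_pos_right (renyiRoof α A B σ) hε)
  calc renyiRoof α A B (a • ρ + b • σ) ≤ a * e + b * f :=
        renyiRoof_le hα (add_mem_ensembleEntropies ha hb hab he hf)
    _ ≤ a * (renyiRoof α A B ρ + ε) + b * (renyiRoof α A B σ + ε) :=
        add_le_add (mul_le_mul_of_nonneg_left he'.le ha) (mul_le_mul_of_nonneg_left hf'.le hb)
    _ = a • renyiRoof α A B ρ + b • renyiRoof α A B σ + ε := by
        simp only [smul_eq_mul]
        linear_combination ε * hab

variable {ψ : A × B → ℂ}

theorem renyiRoof_bipartitePower (hψ : IsUnitVector ψ) (n : ℕ) :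
    renyiRoof α (Fin n → A) (Fin n → B) (pureState (bipartitePower ψ n)) =
      n * renyiEntropy α (reduceA (pureState ψ)) := by
  rw [renyiRoof_pureState (isUnitVector_bipartitePower hψ n), reduceA_pureState_bipartitePower,
    renyiEntropy_tensorPower (isState_reduceA_pureState hψ)]

theorem reduceA_bipartiteTypicalState (n : ℕ) (δ : ℝ) :
    reduceA (bipartiteTypicalState ψ n δ) = typicalState (reduceA (pureState ψ)) n δ := by
  rw [bipartiteTypicalState, typicalState, compress, compress, reduceA_smul,
    reduceA_mul_kronecker, reduceA_kronecker_mul, trace_kronecker_mul,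
    reduceA_pureState_bipartitePower]

/-- A rank-one projection compresses to a rank-one projection. -/
theorem exists_compress_eq_pureState {ι : Type} [Fintype ι] [DecidableEq ι] {P : Matrix ι ι ℂ}
    {φ : ι → ℂ} {t : ℝ} (hP : Pᴴ = P) (hPP : P * P = P)
    (htr : (P * pureState φ).trace = t) (ht : 0 < t) :
    ∃ χ : ι → ℂ, IsUnitVector χ ∧ compress P (pureState φ) = pureState χ ∧
      ‖star φ ⬝ᵥ χ‖ ^ 2 = t := by
  have hc : compress P (pureState φ) = pureState ((((√t)⁻¹ : ℝ) : ℂ) • (P *ᵥ φ)) := by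
    rw [pureState_smul, ← conj_pureState, hP, compress, htr, inv_pow, Real.sq_sqrt ht.le,
      Complex.ofReal_inv]
  have ht0 : (t : ℂ) ≠ 0 := Complex.ofReal_ne_zero.2 ht.ne'
  have htr' : (P * pureState φ * P).trace = t := by
    rw [Matrix.trace_mul_comm (P * pureState φ) P, ← Matrix.mul_assoc, hPP, htr]
  refine ⟨_, ?_, hc, ?_⟩
  · rw [isUnitVector_iff_trace, ← hc, compress, htr, Matrix.trace_smul, htr', smul_eq_mul,
      inv_mul_cancel₀ ht0]
  -- The overlap is Tr(φ · PφP)/t, and φPφ = tφ makes it t²/t = t.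
  · have h := trace_pureState_mul_pureState φ ((((√t)⁻¹ : ℝ) : ℂ) • (P *ᵥ φ))
    rw [← hc, compress, htr, Matrix.mul_smul, Matrix.trace_smul, ← Matrix.mul_assoc,
      ← Matrix.mul_assoc, pureState_mul_mul_pureState, htr, Matrix.smul_mul, Matrix.trace_smul,
      Matrix.trace_mul_comm, htr, smul_eq_mul, smul_eq_mul, inv_mul_cancel_left₀ ht0] at h
    exact_mod_cast h.symm

/-- Once the typical mass t is positive, the compression is a pure state with squared overlap t, so
its trace distance is 2√(1-t). Both roofs are then entropies of reductions, and the limit for mixed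
states applies. -/
theorem bipartiteTypicalState_convergence (hα : α < 1) (hψ : IsUnitVector ψ) {δ : ℕ → ℝ}
    (hδ : Tendsto (fun n : ℕ => √(n : ℝ) * δ n) atTop atTop) :
    (∀ᶠ n in atTop, IsState (bipartiteTypicalState ψ n (δ n))) ∧
      Tendsto (fun n => traceNorm (pureState (bipartitePower ψ n) -
        bipartiteTypicalState ψ n (δ n))) atTop (𝓝 0) ∧
      (Tendsto δ atTop (𝓝 0) →
        Tendsto (fun n : ℕ => (renyiRoof α (Fin n → A) (Fin n → B)
            (pureState (bipartitePower ψ n)) -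
          renyiRoof α (Fin n → A) (Fin n → B) (bipartiteTypicalState ψ n (δ n))) / n)
        atTop (𝓝 (renyiEntropy α (reduceA (pureState ψ)) -
          vonNeumannEntropy (reduceA (pureState ψ))))) := by
  have hρ := isState_reduceA_pureState hψ
  obtain ⟨t, ht, htr⟩ := exists_trace_typicalProjection_mul hρ hδ
  have hev : ∀ᶠ n in atTop, ∃ χ, IsUnitVector χ ∧
      bipartiteTypicalState ψ n (δ n) = pureState χ ∧
      ‖star (bipartitePower ψ n) ⬝ᵥ χ‖ ^ 2 = t n := by
    filter_upwards [ht.eventually_const_lt one_pos] with n hn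
    refine exists_compress_eq_pureState ?_ ?_ ?_ hn
    · rw [Matrix.conjTranspose_kronecker, typicalProjection_conjTranspose hρ,
        Matrix.conjTranspose_one]
    · rw [← Matrix.mul_kronecker_mul, typicalProjection_mul_self hρ, Matrix.one_mul]
    · rw [trace_kronecker_mul, reduceA_pureState_bipartitePower, htr]
  refine ⟨?_, ?_, fun hδ0 => ?_⟩
  · filter_upwards [hev] with n ⟨χ, hχ, h, _⟩
    rw [h]
    exact isState_pureState hχ
  · have h0 : Tendsto (fun n => 2 * √(1 - t n)) atTop (𝓝 0) := by
      simpa using ((ht.const_sub 1).sqrt).const_mul 2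
    refine h0.congr' ?_
    filter_upwards [hev] with n ⟨χ, hχ, h, hn⟩
    rw [h, traceNorm_pureState_sub (isUnitVector_bipartitePower hψ n) hχ, hn]
  · refine (tendsto_renyiEntropy_sub_typicalState hα hρ hδ hδ0).congr' ?_
    filter_upwards [hev] with n ⟨χ, hχ, h, _⟩
    rw [renyiRoof_bipartitePower hψ, renyiEntropy_tensorPower hρ,
      ← reduceA_bipartiteTypicalState, h, renyiRoof_pureState hχ]

end roof

/-! ### Two-level spectra and discontinuity of the Rényi entropy. -/

section twoLevel

/-- The distribution with weight `1 - ε` on one point and `ε` spread evenly over `d` others. -/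
noncomputable def twoLevel (ε : ℝ) (d : ℕ) : Fin (d + 1) → ℝ := Fin.cons (1 - ε) fun _ => ε / d

variable {α ε : ℝ} {d : ℕ}

theorem twoLevel_nonneg (h0 : 0 ≤ ε) (h1 : ε ≤ 1) (i : Fin (d + 1)) : 0 ≤ twoLevel ε d i := by
  refine Fin.cases ?_ (fun j => ?_) i
  · simpa [twoLevel] using h1
  · simp only [twoLevel, Fin.cons_succ]
    positivity

theorem sum_twoLevel (ε : ℝ) (hd : 0 < d) : ∑ i, twoLevel ε d i = 1 := by
  have : (d : ℝ) ≠ 0 := Nat.cast_ne_zero.2 hd.ne'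
  simp only [twoLevel, Fin.sum_univ_succ, Fin.cons_zero, Fin.cons_succ, Finset.sum_const,
    Finset.card_univ, Fintype.card_fin, nsmul_eq_mul]
  field_simp
  ring

theorem logb_powerSum_twoLevel_zero (d : ℕ) : Real.logb 2 (powerSum α (twoLevel 0 d)) = 0 := by
  simp [powerSum, twoLevel, Fin.sum_univ_succ]

theorem logb_powerSum_twoLevel_one_le (hα : α < 1) (hd : 0 < d) :
    1 / (1 - α) * Real.logb 2 (powerSum α (twoLevel 1 d)) ≤ Real.logb 2 d := by
  have hd' : (0 : ℝ) < 1 / d := by positivity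
  have := (logb_powerSum_mem_Icc hα (twoLevel_nonneg zero_le_one le_rfl) (sum_twoLevel 1 hd) hd'
    hd' (by
      intro i
      refine Fin.cases ?_ (fun j => ?_) i
      · simp [twoLevel]
      · simp [twoLevel])).2
  rwa [one_div (d : ℝ), Real.logb_inv, neg_neg] at this

/-- The d small weights alone contribute d(ε/d)^α = d^(1-α) ε^α to the power sum. -/
theorem le_logb_powerSum_twoLevel (hα : α < 1) (h0 : 0 < ε) (h1 : ε ≤ 1) (hd : 0 < d) :
    Real.logb 2 d + α / (1 - α) * Real.logb 2 ε ≤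
      1 / (1 - α) * Real.logb 2 (powerSum α (twoLevel ε d)) := by
  have hd0 : (0 : ℝ) < d := Nat.cast_pos.2 hd
  have hq : 0 < ε / d := by positivity
  have hqα : 0 < (ε / d) ^ α := Real.rpow_pos_of_pos hq α
  have hα' : 0 < 1 - α := by linarith
  have hle : d * (ε / d) ^ α ≤ powerSum α (twoLevel ε d) := by
    simp only [powerSum, twoLevel, Fin.sum_univ_succ, Fin.cons_zero, Fin.cons_succ, if_neg hq.ne',
      Finset.sum_const, Finset.card_univ, Fintype.card_fin, nsmul_eq_mul]
    refine le_add_of_nonneg_left ?_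
    split_ifs
    · exact le_rfl
    · exact Real.rpow_nonneg (by linarith) α
  have hlog := Real.logb_le_logb_of_le one_lt_two (mul_pos hd0 hqα) hle
  rw [Real.logb_mul hd0.ne' hqα.ne', Real.logb_rpow_eq_mul_logb_of_pos hq,
    Real.logb_div h0.ne' hd0.ne'] at hlog
  rw [one_div_mul_eq_div, le_div_iff₀ hα']
  calc _ = (1 - α) * Real.logb 2 d + α * Real.logb 2 ε := by field_simp
    _ ≤ _ := by linarith

theorem exists_lt_logb_natCast (D : ℕ) (C : ℝ) : ∃ d : ℕ, D ≤ d ∧ 0 < d ∧ C < Real.logb 2 d := by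
  have h : Tendsto (fun d : ℕ => Real.logb 2 d) atTop atTop :=
    (Real.tendsto_logb_atTop one_lt_two).comp tendsto_natCast_atTop_atTop
  exact ((eventually_ge_atTop D).and
    ((eventually_gt_atTop 0).and (h.eventually_gt_atTop C))).exists

theorem logb_succ_le (hd : 0 < d) : Real.logb 2 ((d + 1 : ℕ) : ℝ) ≤ Real.logb 2 d + 1 := by
  have hd1 : (1 : ℝ) ≤ d := Nat.one_le_cast.2 hd
  calc Real.logb 2 ((d + 1 : ℕ) : ℝ) ≤ Real.logb 2 (d * 2) := by
        refine Real.logb_le_logb_of_le one_lt_two (by positivity) ?_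
        push_cast
        linarith
    _ = _ := by
        rw [Real.logb_mul (by positivity) two_ne_zero, Real.logb_self_eq_one one_lt_two]

theorem exists_lt_abs_twoLevel_sub (hα : α < 1) (h0 : 0 < ε) (h1 : ε ≤ 1) (D : ℕ) :
    ∃ d : ℕ, D ≤ d ∧ 0 < d ∧ 1 / 2 * Real.logb 2 ((d + 1 : ℕ) : ℝ) <
      |1 / (1 - α) * Real.logb 2 (powerSum α (twoLevel ε d)) -
        1 / (1 - α) * Real.logb 2 (powerSum α (twoLevel 0 d))| := by
  -- The threshold is what makes (log d + 1)/2, a bound for half of log (d+1), smaller than the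
  -- lower bound for the entropy.
  obtain ⟨d, hD, hd, hlog⟩ := exists_lt_logb_natCast D (1 - 2 * (α / (1 - α) * Real.logb 2 ε))
  refine ⟨d, hD, hd, lt_of_lt_of_le ?_ (le_abs_self _)⟩
  rw [logb_powerSum_twoLevel_zero]
  linarith [le_logb_powerSum_twoLevel hα h0 h1 hd, logb_succ_le hd]

theorem not_asymptoticallyContinuous_renyiEntropy (hα : α < 1) :
    ¬ AsymptoticallyContinuous (fun ι _ _ => renyiEntropy α (ι := ι)) := by
  intro h
  obtain ⟨η, hη, D, h⟩ := h (1 / 2) (by norm_num)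
  -- The trace distance between the two diagonal states is 2ε.
  set ε := min 1 (η / 3) with hε
  have h0 : 0 < ε := lt_min one_pos (by linarith)
  have h1 : ε ≤ 1 := min_le_left _ _
  have h2 : ε ≤ η / 3 := min_le_right _ _
  obtain ⟨d, hD, hd, hlt⟩ := exists_lt_abs_twoLevel_sub hα h0 h1 D
  have hnorm : traceNorm ((Matrix.diagonal fun i => (twoLevel ε d i : ℂ)) -
      Matrix.diagonal fun i => (twoLevel 0 d i : ℂ)) < η := by
    rw [← spectralMatrix_one, ← spectralMatrix_one, ← spectralMatrix_sub,
      traceNorm_spectralMatrix (one_mem _)]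
    have hd0 : (d : ℝ) ≠ 0 := Nat.cast_ne_zero.2 hd.ne'
    simp only [Pi.sub_apply, twoLevel, Fin.sum_univ_succ, Fin.cons_zero, Fin.cons_succ, zero_div,
      sub_zero, Finset.sum_const, Finset.card_univ, Fintype.card_fin, nsmul_eq_mul]
    rw [sub_sub_cancel_left, abs_neg, abs_of_pos h0, abs_of_nonneg (by positivity),
      mul_div_cancel₀ _ hd0]
    linarith
  have := h (Fin (d + 1)) (by rw [Fintype.card_fin]; omega) _ _
    (isState_diagonal (twoLevel_nonneg h0.le h1) (sum_twoLevel ε hd))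
    (isState_diagonal (twoLevel_nonneg le_rfl zero_le_one) (sum_twoLevel 0 hd)) hnorm
  simp only [renyiEntropy_diagonal, Fintype.card_fin] at this
  exact absurd this (not_le.2 hlt)

end twoLevel

/-! ### Bipartite vectors with prescribed Schmidt coefficients. -/

section schmidt

variable {A B : Type} [Fintype A] [DecidableEq A] [Fintype B] [DecidableEq B] {α : ℝ}

/-- The vector `∑ b, √(q b) |g b⟩|b⟩`. -/
noncomputable def schmidtVector (g : B → A) (q : B → ℝ) : A × B → ℂ :=
  fun x => if x.1 = g x.2 then (√(q x.2) : ℂ) else 0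

omit [Fintype B] [DecidableEq B] [Fintype A] in
theorem schmidtVector_apply (g : B → A) (q : B → ℝ) (a : A) (b : B) :
    schmidtVector g q (a, b) = if a = g b then (√(q b) : ℂ) else 0 := rfl

variable {g : B → A} {q : B → ℝ}

omit [DecidableEq B] in
theorem isUnitVector_schmidtVector (hq : ∀ b, 0 ≤ q b) (hq1 : ∑ b, q b = 1) :
    IsUnitVector (schmidtVector g q) := by
  rw [IsUnitVector, Fintype.sum_prod_type_right, ← hq1]
  refine Finset.sum_congr rfl fun b _ => ?_
  rw [Finset.sum_eq_single (g b)]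
  · simp [schmidtVector_apply, Real.sq_sqrt (hq b)]
  · intro a _ ha
    simp [schmidtVector_apply, ha]
  · simp

omit [Fintype A] [DecidableEq B] in
theorem reduceA_schmidtVector (hq : ∀ b, 0 ≤ q b) :
    reduceA (pureState (schmidtVector g q)) =
      Matrix.diagonal fun a => ((∑ b, if a = g b then q b else 0 : ℝ) : ℂ) := by
  ext a a'
  simp only [reduceA, pureState, Matrix.of_apply, Matrix.vecMulVec_apply, Pi.star_apply,
    schmidtVector_apply]
  by_cases h : a = a'
  · subst h
    rw [Matrix.diagonal_apply_eq, Complex.ofReal_sum]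
    refine Finset.sum_congr rfl fun b _ => ?_
    split_ifs
    · rw [RCLike.star_def, Complex.conj_ofReal, ← Complex.ofReal_mul, Real.mul_self_sqrt (hq b)]
    · simp
  · rw [Matrix.diagonal_apply_ne _ h]
    refine Finset.sum_eq_zero fun b _ => ?_
    split_ifs with h1 h2
    · exact absurd (h1.trans h2.symm) h
    all_goals simp

/-- Injectivity of `g` prevents weights from merging; points outside its range have weight 0 and are
dropped. -/
theorem powerSum_embedding (hg : Function.Injective g) :
    powerSum α (fun a => ∑ b, if a = g b then q b else 0) = powerSum α q := by
  have himg (b : B) : ∑ b', (if g b = g b' then q b' else 0) = q b := by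
    simp [hg.eq_iff]
  rw [powerSum, powerSum, ← Finset.sum_subset (Finset.subset_univ (Finset.univ.image g)),
    Finset.sum_image hg.injOn]
  · simp only [himg]
  · intro a _ ha
    rw [if_pos]
    refine Finset.sum_eq_zero fun b _ => if_neg ?_
    rintro rfl
    exact ha (Finset.mem_image_of_mem g (Finset.mem_univ b))

theorem renyiEntropy_schmidtVector (hg : Function.Injective g) (hq : ∀ b, 0 ≤ q b) :
    renyiEntropy α (reduceA (pureState (schmidtVector g q))) =
      1 / (1 - α) * Real.logb 2 (powerSum α q) := by
  rw [reduceA_schmidtVector hq, renyiEntropy_diagonal, powerSum_embedding hg]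

theorem renyiRoof_schmidtVector (hg : Function.Injective g) (hq : ∀ b, 0 ≤ q b)
    (hq1 : ∑ b, q b = 1) :
    renyiRoof α A B (pureState (schmidtVector g q)) =
      1 / (1 - α) * Real.logb 2 (powerSum α q) := by
  rw [renyiRoof_pureState (isUnitVector_schmidtVector hq hq1), renyiEntropy_schmidtVector hg hq]

end schmidt

/-! ### Discontinuity and locking of the convex roof. -/

section counterexamples

variable {α ε : ℝ} {d : ℕ}

theorem norm_dotProduct_schmidtVector_twoLevel (h1 : ε ≤ 1) :
    ‖star (schmidtVector id (twoLevel ε d)) ⬝ᵥ schmidtVector id (twoLevel 0 d)‖ ^ 2 = 1 - ε := by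
  -- At ε = 0 the vector is a product basis vector, so the overlap reads off the amplitude √(1-ε).
  have : schmidtVector id (twoLevel 0 d) = Pi.single (0, 0) 1 := by
    ext ⟨a, b⟩
    rw [schmidtVector_apply]
    refine Fin.cases ?_ (fun j => ?_) b
    · by_cases h : a = 0 <;> simp [h, twoLevel]
    · rw [Pi.single_eq_of_ne (by simp)]
      simp [twoLevel]
  rw [this, dotProduct_single_one, Pi.star_apply, schmidtVector_apply]
  simp [twoLevel, Real.sq_sqrt (sub_nonneg.2 h1)]

theorem not_bipartiteAsymptoticallyContinuous_renyiRoof (hα : α < 1) :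
    ¬ BipartiteAsymptoticallyContinuous (renyiRoof α) := by
  intro h
  -- The joint dimension is (d+1)², whose logarithm is twice that of d+1; hence 1/4 in place of 1/2.
  -- The trace distance of the pure states is 2√ε, hence the square in the choice of ε.
  obtain ⟨η, hη, D, h⟩ := h (1 / 4) (by norm_num)
  set ε := min 1 ((η / 3) ^ 2) with hε
  have h0 : 0 < ε := lt_min one_pos (by positivity)
  have h1 : ε ≤ 1 := min_le_left _ _
  have h2 : ε ≤ (η / 3) ^ 2 := min_le_right _ _
  obtain ⟨d, hD, hd, hlt⟩ := exists_lt_abs_twoLevel_sub hα h0 h1 D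
  have hp := twoLevel_nonneg (d := d) h0.le h1
  have hp1 := sum_twoLevel ε hd
  have hq := twoLevel_nonneg (d := d) le_rfl zero_le_one
  have hq1 := sum_twoLevel 0 hd
  have hψ := isUnitVector_schmidtVector (g := id) hp hp1
  have hφ := isUnitVector_schmidtVector (g := id) hq hq1
  have hnorm : traceNorm (pureState (schmidtVector id (twoLevel ε d)) -
      pureState (schmidtVector id (twoLevel 0 d))) < η := by
    rw [traceNorm_pureState_sub hψ hφ, norm_dotProduct_schmidtVector_twoLevel h1, sub_sub_cancel]
    have := Real.sqrt_le_left (y := η / 3) (by positivity) |>.2 h2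
    linarith
  have hcard : Fintype.card (Fin (d + 1) × Fin (d + 1)) = (d + 1) ^ 2 := by simp [sq]
  have := h (Fin (d + 1)) (Fin (d + 1)) (by rw [hcard]; nlinarith) _ _
    (isState_pureState hψ) (isState_pureState hφ) hnorm
  rw [renyiRoof_schmidtVector Function.injective_id hp hp1,
    renyiRoof_schmidtVector Function.injective_id hq hq1, hcard, Nat.cast_pow,
    Real.logb_pow] at this
  push_cast at this hlt
  linarith

/-- The flag qubit separates the two levels: it is `0` on the first point and `1` on the rest. -/
def levelFlag {d : ℕ} (b : Fin (d + 1)) : Fin (d + 1) × Fin 2 := (b, if b = 0 then 0 else 1)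

theorem levelFlag_injective : Function.Injective (levelFlag (d := d)) :=
  fun _ _ h => congrArg Prod.fst h

/-- The flag is orthogonal between the two levels, so tracing it out removes the coherence between
them and leaves each level with weight 1/2. -/
theorem discardQubit_levelFlag (d : ℕ) :
    discardQubit (pureState (schmidtVector levelFlag (twoLevel (1 / 2) d))) =
      (1 / 2 : ℝ) • pureState (schmidtVector id (twoLevel 0 d)) +
        (1 / 2 : ℝ) • pureState (schmidtVector id (twoLevel 1 d)) := by
  have hsq (x : ℝ) (hx : 0 ≤ x) : (√x : ℂ) * √x = x := by
    rw [← Complex.ofReal_mul, Real.mul_self_sqrt hx]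
  have hhalf := hsq (1 / 2) (by norm_num)
  have h2 : ((√2 : ℝ) : ℂ)⁻¹ ^ 2 = 1 / 2 := by
    rw [inv_pow, sq, hsq 2 two_pos.le]
    norm_num
  ext ⟨a, b⟩ ⟨a', b'⟩
  simp only [discardQubit, pureState, Matrix.of_apply, Matrix.vecMulVec_apply, Pi.star_apply,
    Matrix.add_apply, Matrix.smul_apply, schmidtVector_apply, levelFlag, Fin.sum_univ_two,
    Prod.mk.injEq, id_eq]
  rcases eq_or_ne a b with rfl | ha
  swap
  · simp [ha]
  rcases eq_or_ne a' b' with rfl | ha'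
  swap
  · simp [ha']
  have hone : (1 : ℝ) - 1 / 2 = 1 / 2 := by norm_num
  -- In the two mixed cases the left side vanishes because the flags differ, and the right side
  -- because each summand has a zero amplitude.
  refine Fin.cases ?_ (fun j => ?_) a <;> refine Fin.cases ?_ (fun j' => ?_) a'
  · simp only [twoLevel, Fin.cons_zero, hone]
    simpa using hhalf
  · simp [twoLevel]
  · simp [twoLevel]
  · simp only [twoLevel, Fin.cons_succ]
    simp [-one_div]
    linear_combination ((√(d : ℝ) : ℂ)⁻¹) ^ 2 * h2

/-- With the flag the roof is at least log d plus a constant. Without it, convexity bounds the roof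
by half of 0 plus half of log d, so the gap grows like (log d)/2. -/
theorem admitsLocking_renyiRoof (hα : α < 1) : AdmitsLocking (renyiRoof α) := by
  intro K
  obtain ⟨d, -, hd, hlog⟩ :=
    exists_lt_logb_natCast 0 (2 * (K - α / (1 - α) * Real.logb 2 (1 / 2)))
  have hhalf : (0 : ℝ) ≤ 1 / 2 := by norm_num
  have hhalf' : (1 / 2 : ℝ) ≤ 1 := by norm_num
  have hp := twoLevel_nonneg (d := d) hhalf hhalf'
  have hp1 := sum_twoLevel (1 / 2) hd
  have hq := twoLevel_nonneg (d := d) le_rfl zero_le_one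
  have hr := twoLevel_nonneg (d := d) zero_le_one le_rfl
  have hψ := isUnitVector_schmidtVector (g := levelFlag (d := d)) hp hp1
  refine ⟨d + 1, d + 1, _, isState_pureState hψ, ?_⟩
  rw [renyiRoof_schmidtVector levelFlag_injective hp hp1, discardQubit_levelFlag d]
  have hconv := (convexOn_renyiRoof hα).2
    (isState_pureState (isUnitVector_schmidtVector (g := id) hq (sum_twoLevel 0 hd)))
    (isState_pureState (isUnitVector_schmidtVector (g := id) hr (sum_twoLevel 1 hd)))
    hhalf hhalf (by norm_num)
  rw [renyiRoof_schmidtVector Function.injective_id hq (sum_twoLevel 0 hd),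
    renyiRoof_schmidtVector Function.injective_id hr (sum_twoLevel 1 hd),
    logb_powerSum_twoLevel_zero, smul_eq_mul, smul_eq_mul] at hconv
  linarith [logb_powerSum_twoLevel_one_le hα hd,
    le_logb_powerSum_twoLevel hα one_half_pos hhalf' hd]

end counterexamples

theorem mainTheorem6 (α : ℝ) (hα₀ : 0 ≤ α) (hα₁ : α < 1) :
    -- the Rényi entropy dominates the von Neumann entropy, strictly off flat spectra
    (∀ (A : Type) [Fintype A] [DecidableEq A] (ρ : Matrix A A ℂ), IsState ρ →
      vonNeumannEntropy ρ ≤ renyiEntropy α ρ ∧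
      (renyiEntropy α ρ = vonNeumannEntropy ρ ↔ ∃ c : ℝ, ρ * ρ = (c : ℂ) • ρ)) ∧
    -- tensor powers against their typical compressions
    (∀ (A : Type) [Fintype A] [DecidableEq A] (ρ : Matrix A A ℂ), IsState ρ →
      (∀ n : ℕ, IsState (tensorPower ρ n) ∧
        renyiEntropy α (tensorPower ρ n) = n * renyiEntropy α ρ) ∧
      ∀ δ : ℕ → ℝ, Tendsto (fun n : ℕ => √(n : ℝ) * δ n) atTop atTop →
        (∀ᶠ n in atTop, IsState (typicalState ρ n (δ n))) ∧
        Tendsto (fun n => traceNorm (tensorPower ρ n - typicalState ρ n (δ n)))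
          atTop (𝓝 0) ∧
        (Tendsto δ atTop (𝓝 0) →
          Tendsto (fun n : ℕ => renyiEntropy α (typicalState ρ n (δ n)) / n)
            atTop (𝓝 (vonNeumannEntropy ρ)) ∧
          Tendsto (fun n : ℕ => (renyiEntropy α (tensorPower ρ n) -
              renyiEntropy α (typicalState ρ n (δ n))) / n)
            atTop (𝓝 (renyiEntropy α ρ - vonNeumannEntropy ρ)))) ∧
    -- the Rényi entropy is not asymptotically continuous
    ¬ AsymptoticallyContinuous (fun ι _ _ => renyiEntropy α (ι := ι)) ∧
    -- the convex-roof measure is convex and extends the Rényi entropy of the subsystem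
    (∀ (A B : Type) [Fintype A] [DecidableEq A] [Fintype B] [DecidableEq B],
      ConvexOn ℝ {ρ : Matrix (A × B) (A × B) ℂ | IsState ρ} (renyiRoof α A B) ∧
      ∀ ψ : A × B → ℂ, IsUnitVector ψ →
        renyiRoof α A B (pureState ψ) = renyiEntropy α (reduceA (pureState ψ))) ∧
    -- the witness on bipartite pure states
    (∀ (A B : Type) [Fintype A] [DecidableEq A] [Fintype B] [DecidableEq B]
      (ψ : A × B → ℂ), IsUnitVector ψ →
      (∀ n : ℕ, IsState (pureState (bipartitePower ψ n)) ∧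
        renyiRoof α (Fin n → A) (Fin n → B) (pureState (bipartitePower ψ n)) =
          n * renyiEntropy α (reduceA (pureState ψ))) ∧
      ∀ δ : ℕ → ℝ, Tendsto (fun n : ℕ => √(n : ℝ) * δ n) atTop atTop →
        (∀ᶠ n in atTop, IsState (bipartiteTypicalState ψ n (δ n))) ∧
        (∀ n, reduceA (bipartiteTypicalState ψ n (δ n)) =
          typicalState (reduceA (pureState ψ)) n (δ n)) ∧
        Tendsto (fun n => traceNorm
            (pureState (bipartitePower ψ n) - bipartiteTypicalState ψ n (δ n)))
          atTop (𝓝 0) ∧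
        (Tendsto δ atTop (𝓝 0) →
          Tendsto (fun n : ℕ => (renyiRoof α (Fin n → A) (Fin n → B)
                (pureState (bipartitePower ψ n)) -
              renyiRoof α (Fin n → A) (Fin n → B) (bipartiteTypicalState ψ n (δ n))) / n)
            atTop (𝓝 (renyiEntropy α (reduceA (pureState ψ)) -
              vonNeumannEntropy (reduceA (pureState ψ)))))) ∧
    -- the convex-roof measure is not asymptotically continuous, and it admits locking
    ¬ BipartiteAsymptoticallyContinuous (renyiRoof α) ∧
    AdmitsLocking (renyiRoof α) := by
  refine ⟨fun A _ _ ρ hρ => vonNeumannEntropy_le_renyiEntropy hα₁ hρ, fun A _ _ ρ hρ => ?_,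
    not_asymptoticallyContinuous_renyiEntropy hα₁, fun A B _ _ _ _ => ?_,
    fun A B _ _ _ _ ψ hψ => ?_, not_bipartiteAsymptoticallyContinuous_renyiRoof hα₁,
    admitsLocking_renyiRoof hα₁⟩
  · refine ⟨fun n => ⟨isState_tensorPower hρ n, renyiEntropy_tensorPower hρ n⟩, fun δ hδ => ?_⟩
    obtain ⟨h1, h2, h3⟩ := typicalState_convergence hα₁ hρ hδ
    exact ⟨h1, h2, fun hδ0 => ⟨h3 hδ0, tendsto_renyiEntropy_sub_typicalState hα₁ hρ hδ hδ0⟩⟩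
  · exact ⟨convexOn_renyiRoof hα₁, fun ψ hψ => renyiRoof_pureState hψ⟩
  · refine ⟨fun n => ⟨isState_pureState (isUnitVector_bipartitePower hψ n),
      renyiRoof_bipartitePower hψ n⟩, fun δ hδ => ?_⟩
    obtain ⟨h1, h2, h3⟩ := bipartiteTypicalState_convergence hα₁ hψ hδ
    exact ⟨h1, fun n => reduceA_bipartiteTypicalState n (δ n), h2, h3⟩
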